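/- Let $d \ge 2$ be an integer and $p > 1$. For $x,y\in\mathbb R^d$ and $A\subset\mathbb R^d$ let $L(x,y;A)$ denote the power-weighted shortest path length from $x$ to $y$ through $A\cup\{x,y\}$, i.e. the infimum of $\sum_{i=0}^{k-1}|\pi_i-\pi_{i+1}|^p$ over all finite sequences $\pi_0=x,\pi_1,\dots,\pi_k=y$ of points of $A\cup\{x,y\}$. For each $\lambda>0$ let $\mathcal H_\lambda$ be a homogeneous Poisson point process of intensity $\lambda$ in $\mathbb R^d$, and let $e_1=(1,0,\dots,0)$. The limit $$C(d,p)=\lim_{t\to\infty}\frac1t\,\mathbb E\,L(0,te_1;\mathcal H_1)$$ exists in $\mathbb R$ and depends only on $d$ and $p$, and the following holds. Let $z\in\mathbb R^d$, $R_2>R_1>0$ and $\alpha=(d+2p-1)^{-1}$. Let $x_\lambda,y_\lambda\in B(z;R_1)$ be functions of $\lambda>0$ with $\lambda^\alpha|x_\lambda-y_\lambda|\to+\infty$ as $\lambda\to\infty$. Fix $\varepsilon>0$ and let $E_\lambda$ be the event that $$\frac{L(x_\lambda,y_\lambda;\mathcal H_\lambda\cap B(z;R_2))}{\lambda^{(1-p)/d}\,|x_\lambda-y_\lambda|}\le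 C(d,p)+\varepsilon .$$ Then $$\limsup_{\lambda\to\infty}\frac{1}{\lambda^\alpha|x_\lambda-y_\lambda|}\log\bigl(1-\Pr(E_\lambda)\bigr)<0,$$ where $\log 0=-\infty$, $B(z;R)$ is the open Euclidean ball of radius $R$ centred at $z$, and $|\cdot|$ is the Euclidean norm. -/

import Mathlib

open MeasureTheory ProbabilityTheory Filter Topology

/-- The power-weighted length `∑ |π i - π (i+1)| ^ p` of the path `π 0, π 1, …, π k`. -/
noncomputable def pathCost {E : Type*} [PseudoMetricSpace E] (p : ℝ) (k : ℕ) (π : ℕ → E) : ℝ :=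
  ∑ i ∈ Finset.range k, dist (π i) (π (i + 1)) ^ p

/-- The power-weighted shortest path length from `x` to `y` through `A ∪ {x, y}`: the infimum of
the power-weighted lengths of the finite paths from `x` to `y` with all vertices in `A ∪ {x, y}`.
The set of these lengths is bounded below by `0`, and the direct path shows that it is nonempty. -/
noncomputable def shortestPathLength {E : Type*} [PseudoMetricSpace E]
    (p : ℝ) (x y : E) (A : Set E) : ℝ :=
  sInf {c : ℝ | ∃ (k : ℕ) (π : ℕ → E), π 0 = x ∧ π k = y ∧
    (∀ i ≤ k, π i ∈ A ∪ {x, y}) ∧ c = pathCost p k π}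

/-- The random set `H` is a homogeneous Poisson point process of intensity `lam` in `ℝ^d`:
it is almost surely locally finite, the number of points in a Borel set is a random variable, which
has the Poisson distribution of mean `lam * volume B` when `B` has finite volume, and the numbers of
points in pairwise disjoint Borel sets are independent. -/
structure IsPoissonProcess {Ω : Type*} [MeasurableSpace Ω] (μ : Measure Ω) {d : ℕ} (lam : ℝ)
    (H : Ω → Set (EuclideanSpace ℝ (Fin d))) : Prop where
  locallyFinite : ∀ᵐ ω ∂μ, ∀ B : Set (EuclideanSpace ℝ (Fin d)),
    Bornology.IsBounded B → (H ω ∩ B).Finite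
  measurable_count : ∀ B : Set (EuclideanSpace ℝ (Fin d)), MeasurableSet B →
    Measurable fun ω => (H ω ∩ B).encard
  count_law : ∀ B : Set (EuclideanSpace ℝ (Fin d)), MeasurableSet B → volume B ≠ ⊤ →
    μ.map (fun ω => (H ω ∩ B).encard) =
      (poissonMeasure (lam * (volume B).toReal).toNNReal).map (fun n : ℕ => (n : ℕ∞))
  indep_count : ∀ (n : ℕ) (B : Fin n → Set (EuclideanSpace ℝ (Fin d))),
    (∀ i, MeasurableSet (B i)) → Pairwise (fun i j => Disjoint (B i) (B j)) →
      iIndepFun (fun i ω => (H ω ∩ B i).encard) μ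

/-! Rescaling turns the intensity into one and the segment from `x` to `y` into `[0, t e]` with `t =
λ^(1/d) |x - y|`. Cut it into `4n` blocks of length `m` and route a path through Poisson points near
the cut points. By `exists_shortestPathLength_le_sum` this costs a factor `κ`, as close to 1 as
desired, on the sum of the block lengths, plus a constant times the `p`-th powers of the rerouting
distances.

The cost of a block depends only on the points within `2m` of its start, so blocks with the same
index mod 4 are independent. It is at most a constant times `m^p`, and for large `m` its mean is at
most `(C + ε/2) m`. Hoeffding's inequality bounds the probability of a large excess by `exp(-c n
m^(2-2p))`; the other bad event, an empty ball of radius `⌊m⌋` at some cut point, has probability at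
most `4n exp(-c m^d)`. This is `IsPoissonLaw.exists_measureReal_gt_le`. For `m` of order `λ^(α/d)`
the exponents are of orders `λ^α |x - y|` and `λ^α`; as `|x - y| ≤ 2 R₁`, both errors are
exponentially small in `λ^α |x - y|` (`exists_block_scales`).

The same rerouting, applied to means, gives the almost subadditivity from which `C` arises, and
shows that paths confined to a ball of radius `2t` have the same limit
(`IsPoissonLaw.exists_tendsto_mean`). Everything is computed under one law on configurations,
determined by its avoidance probabilities (`IsPoissonLaw.unique`), so `C` does not depend on the
probability space. -/

section Deterministic

/-! ### Shortest path lengths for a fixed set of points: triangle inequality and rerouting. -/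

variable {E : Type*} [PseudoMetricSpace E] {p : ℝ} {x y q s : E} {A A' : Set E}

lemma pathCost_nonneg (p : ℝ) (k : ℕ) (π : ℕ → E) : 0 ≤ pathCost p k π :=
  Finset.sum_nonneg fun _ _ => Real.rpow_nonneg dist_nonneg _

lemma bddBelow_pathCosts (p : ℝ) (x y : E) (A : Set E) :
    BddBelow {c : ℝ | ∃ (k : ℕ) (π : ℕ → E), π 0 = x ∧ π k = y ∧
      (∀ i ≤ k, π i ∈ A ∪ {x, y}) ∧ c = pathCost p k π} :=
  ⟨0, by rintro _ ⟨k, π, -, -, -, rfl⟩; exact pathCost_nonneg p k π⟩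

lemma nonempty_pathCosts (p : ℝ) (x y : E) (A : Set E) :
    {c : ℝ | ∃ (k : ℕ) (π : ℕ → E), π 0 = x ∧ π k = y ∧
      (∀ i ≤ k, π i ∈ A ∪ {x, y}) ∧ c = pathCost p k π}.Nonempty := by
  refine ⟨_, 1, fun i => if i = 0 then x else y, by simp, by simp, fun i _ => ?_, rfl⟩
  by_cases h : i = 0 <;> simp [h]

lemma shortestPathLength_le_pathCost {k : ℕ} {π : ℕ → E} (h0 : π 0 = x) (hk : π k = y)
    (h : ∀ i ≤ k, π i ∈ A ∪ {x, y}) : shortestPathLength p x y A ≤ pathCost p k π :=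
  csInf_le (bddBelow_pathCosts p x y A) ⟨k, π, h0, hk, h, rfl⟩

lemma shortestPathLength_lt_iff {c : ℝ} : shortestPathLength p x y A < c ↔
    ∃ (k : ℕ) (π : ℕ → E), π 0 = x ∧ π k = y ∧ (∀ i ≤ k, π i ∈ A ∪ {x, y}) ∧
      pathCost p k π < c := by
  constructor
  · intro h
    obtain ⟨_, ⟨k, π, h0, hk, hA, rfl⟩, hc⟩ := exists_lt_of_csInf_lt (nonempty_pathCosts p x y A) h
    exact ⟨k, π, h0, hk, hA, hc⟩
  · rintro ⟨k, π, h0, hk, hA, hc⟩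
    exact (shortestPathLength_le_pathCost h0 hk hA).trans_lt hc

lemma le_shortestPathLength {c : ℝ} (h : ∀ (k : ℕ) (π : ℕ → E), π 0 = x → π k = y →
    (∀ i ≤ k, π i ∈ A ∪ {x, y}) → c ≤ pathCost p k π) : c ≤ shortestPathLength p x y A :=
  le_csInf (nonempty_pathCosts p x y A) (by rintro _ ⟨k, π, h0, hk, hA, rfl⟩; exact h k π h0 hk hA)

lemma shortestPathLength_nonneg (p : ℝ) (x y : E) (A : Set E) :
    0 ≤ shortestPathLength p x y A :=
  le_shortestPathLength fun k π _ _ _ => pathCost_nonneg p k π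

lemma shortestPathLength_le_dist (p : ℝ) (x y : E) (A : Set E) :
    shortestPathLength p x y A ≤ dist x y ^ p := by
  have := shortestPathLength_le_pathCost (p := p) (A := A) (x := x) (y := y) (k := 1)
    (π := fun i => if i = 0 then x else y) (by simp) (by simp)
    (fun i _ => by by_cases h : i = 0 <;> simp [h])
  simpa [pathCost] using this

lemma shortestPathLength_self (hp : 1 < p) (x : E) (A : Set E) :
    shortestPathLength p x x A = 0 := by
  refine le_antisymm ?_ (shortestPathLength_nonneg p x x A)
  simpa [Real.zero_rpow (by linarith : p ≠ 0)] using shortestPathLength_le_dist p x x A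

lemma shortestPathLength_anti (h : A ⊆ A') :
    shortestPathLength p x y A' ≤ shortestPathLength p x y A :=
  le_shortestPathLength fun _ _ h0 hk hA => shortestPathLength_le_pathCost h0 hk
    fun i hi => Set.union_subset_union_left _ h (hA i hi)

lemma shortestPathLength_triangle (hq : q ∈ A ∪ {x, y}) :
    shortestPathLength p x y A ≤ shortestPathLength p x q A + shortestPathLength p q y A := by
  rw [← sub_le_iff_le_add]
  refine le_shortestPathLength fun k π h0 hk hA => ?_
  rw [sub_le_comm]
  refine le_shortestPathLength fun l π' h0' hl' hA' => ?_
  rw [sub_le_iff_le_add']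
  have hsub : ∀ z, z ∈ A ∪ {x, q} → z ∈ A ∪ {x, y} := by
    intro z hz; simp only [Set.mem_union, Set.mem_insert_iff, Set.mem_singleton_iff] at hz hq ⊢
    rcases hz with hz | rfl | rfl <;> tauto
  have hsub' : ∀ z, z ∈ A ∪ {q, y} → z ∈ A ∪ {x, y} := by
    intro z hz; simp only [Set.mem_union, Set.mem_insert_iff, Set.mem_singleton_iff] at hz hq ⊢
    rcases hz with hz | rfl | rfl <;> tauto
  refine (shortestPathLength_le_pathCost (k := k + l)
    (π := fun i => if i ≤ k then π i else π' (i - k)) (by simpa using h0) ?_ ?_).trans ?_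
  · by_cases hl : l = 0
    · subst hl; simp [hk, ← hl', h0']
    · rw [if_neg (by omega)]; simpa using hl'
  · intro i hi
    by_cases h : i ≤ k
    · simpa only [h, if_true] using hsub _ (hA i h)
    · simpa only [h, if_false] using hsub' _ (hA' (i - k) (by omega))
  · rw [pathCost, Finset.sum_range_add]
    refine add_le_add (le_of_eq ?_) (le_of_eq ?_)
    · refine Finset.sum_congr rfl fun i hi => ?_
      have := Finset.mem_range.1 hi
      rw [if_pos (by omega), if_pos (by omega)]
    · refine Finset.sum_congr rfl fun i hi => ?_
      have h1 : ¬ k + i + 1 ≤ k := by omega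
      simp only [h1, if_false, show k + i + 1 - k = i + 1 by omega]
      rcases Nat.eq_zero_or_pos i with rfl | hi0
      · simp [hk, h0']
      · have h2 : ¬ k + i ≤ k := by omega
        simp only [h2, if_false, Nat.add_sub_cancel_left]

lemma shortestPathLength_comm (p : ℝ) (x y : E) (A : Set E) :
    shortestPathLength p x y A = shortestPathLength p y x A := by
  have key : ∀ x y : E, shortestPathLength p x y A ≤ shortestPathLength p y x A := by
    intro x y
    refine le_shortestPathLength fun k π h0 hk hA => ?_
    refine (shortestPathLength_le_pathCost (k := k) (π := fun i => π (k - i)) (by simpa using hk)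
      (by simpa using h0) fun i _ => ?_).trans (le_of_eq ?_)
    · rw [Set.pair_comm]; exact hA _ (by omega)
    · rw [pathCost, pathCost, ← Finset.sum_range_reflect]
      refine Finset.sum_congr rfl fun i hi => ?_
      have := Finset.mem_range.1 hi
      rw [dist_comm, show k - (k - 1 - i + 1) = i by omega, show k - (k - 1 - i) = i + 1 by omega]
  exact le_antisymm (key x y) (key y x)

/-- Convexity of the power, applied to `u + v = θ (u/θ) + (1 - θ) (v/(1 - θ))` with `θ` chosen so
that `θ^(1-p) = κ`. The large constant falls on the perturbation `v` only. -/
lemma exists_add_rpow_le (hp : 1 < p) {κ : ℝ} (hκ : 1 < κ) :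
    ∃ C : ℝ, 1 ≤ C ∧ ∀ u v : ℝ, 0 ≤ u → 0 ≤ v → (u + v) ^ p ≤ κ * u ^ p + C * v ^ p := by
  set θ : ℝ := κ ^ (-(p - 1)⁻¹) with hθ
  have hp1 : 0 < p - 1 := by linarith
  have hθ0 : 0 < θ := Real.rpow_pos_of_pos (by linarith) _
  have hθ1 : θ < 1 := Real.rpow_lt_one_of_one_lt_of_neg hκ (by simpa using hp1)
  have hθκ : θ ^ (1 - p) = κ := by
    rw [hθ, ← Real.rpow_mul (by linarith), show -(p - 1)⁻¹ * (1 - p) = 1 by field_simp; ring,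
      Real.rpow_one]
  have aux : ∀ w t : ℝ, 0 ≤ w → 0 < t → t * (w / t) ^ p = t ^ (1 - p) * w ^ p := by
    intro w t hw ht
    rw [Real.div_rpow hw ht.le, Real.rpow_sub ht, Real.rpow_one]; ring
  refine ⟨(1 - θ) ^ (1 - p), Real.one_le_rpow_of_pos_of_le_one_of_nonpos (by linarith)
    (by linarith) (by linarith), fun u v hu hv => ?_⟩
  have h1θ : 0 < 1 - θ := by linarith
  have := (convexOn_rpow hp.le).2 (x := u / θ) (y := v / (1 - θ)) (Set.mem_Ici.2 (by positivity))
    (Set.mem_Ici.2 (by positivity)) hθ0.le h1θ.le (by ring)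
  simp only [smul_eq_mul] at this
  rwa [aux u θ hu hθ0, aux v _ hv h1θ, hθκ, mul_div_cancel₀ _ hθ0.ne',
    mul_div_cancel₀ _ h1θ.ne'] at this

/-- Only the last edge changes: it is redirected from `s` to `q`, which perturbs its length by at
most `dist s q`. -/
lemma shortestPathLength_move_right {κ C : ℝ} (hκ : 1 ≤ κ) (hC1 : 1 ≤ C)
    (hC : ∀ u v : ℝ, 0 ≤ u → 0 ≤ v → (u + v) ^ p ≤ κ * u ^ p + C * v ^ p) (hp : 1 < p)
    (x s q : E) (A : Set E) :
    shortestPathLength p x q A ≤ κ * shortestPathLength p x s A + C * dist s q ^ p := by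
  classical
  have hκ0 : 0 < κ := by linarith
  rw [← sub_le_iff_le_add, ← div_le_iff₀' hκ0]
  refine le_shortestPathLength fun k π h0 hk hA => ?_
  rw [div_le_iff₀' hκ0, sub_le_iff_le_add]
  -- The path is cut at its first visit to `s`, because `s` need not be an admissible vertex for the
  -- new endpoints; earlier vertices then lie in `A ∪ {x}`.
  have hex : ∃ j, π j = s := ⟨k, hk⟩
  obtain ⟨j, hj⟩ : ∃ j, j = Nat.find hex := ⟨_, rfl⟩
  have hjs : π j = s := hj ▸ Nat.find_spec hex
  have hjk : j ≤ k := hj ▸ Nat.find_min' hex hk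
  have hjm : ∀ i < j, π i ≠ s := fun i hi => Nat.find_min hex (hj ▸ hi)
  have hd : 0 ≤ dist s q ^ p := Real.rpow_nonneg dist_nonneg _
  rcases Nat.eq_zero_or_pos j with rfl | hj0
  · have hxs : x = s := by rw [← h0, hjs]
    subst hxs
    have := shortestPathLength_le_dist p x q A
    have := mul_nonneg hκ0.le (pathCost_nonneg p k π)
    nlinarith
  obtain ⟨l, rfl⟩ : ∃ l, j = l + 1 := ⟨j - 1, by omega⟩
  have hle : shortestPathLength p x q A ≤
      pathCost p (l + 1) (fun i => if i ≤ l then π i else q) := by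
    refine shortestPathLength_le_pathCost (by simpa using h0) (by simp) fun i hi => ?_
    by_cases h : i ≤ l
    · have := hA i (by omega)
      have h' := hjm i (by omega)
      simp only [h, if_true]
      simp only [Set.mem_union, Set.mem_insert_iff, Set.mem_singleton_iff] at this ⊢
      tauto
    · simp [h]
  refine hle.trans ?_
  have h1 : pathCost p (l + 1) (fun i => if i ≤ l then π i else q) =
      pathCost p l π + dist (π l) q ^ p := by
    rw [pathCost, Finset.sum_range_succ]
    simp only [le_refl, if_true]
    rw [if_neg (by omega)]
    congr 1
    refine Finset.sum_congr rfl fun i hi => ?_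
    have := Finset.mem_range.1 hi
    rw [if_pos (by omega), if_pos (by omega)]
  have h2 : pathCost p l π + dist (π l) s ^ p ≤ pathCost p k π := by
    rw [← hjs]
    have : pathCost p (l + 1) π ≤ pathCost p k π :=
      Finset.sum_le_sum_of_subset_of_nonneg (by simpa using hjk)
        fun i _ _ => Real.rpow_nonneg dist_nonneg _
    rwa [pathCost, Finset.sum_range_succ] at this
  have h3 : dist (π l) q ^ p ≤ κ * dist (π l) s ^ p + C * dist s q ^ p :=
    (Real.rpow_le_rpow dist_nonneg (dist_triangle _ s _) (by linarith)).trans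
      (hC _ _ dist_nonneg dist_nonneg)
  have h4 := pathCost_nonneg p l π
  rw [h1]
  nlinarith

lemma shortestPathLength_le_sum (hp : 1 < p) (q : ℕ → E) (n : ℕ)
    (hq : ∀ i, 0 < i → i < n → q i ∈ A) :
    shortestPathLength p (q 0) (q n) A ≤
      ∑ i ∈ Finset.range n, shortestPathLength p (q i) (q (i + 1)) A := by
  induction n with
  | zero => simp [shortestPathLength_self hp]
  | succ n ih =>
    rw [Finset.sum_range_succ]
    refine (shortestPathLength_triangle (q := q n) ?_).trans
      (add_le_add (ih fun i h h' => hq i h (by omega)) le_rfl)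
    rcases Nat.eq_zero_or_pos n with rfl | hn
    · simp
    · exact Or.inl (hq n hn (by omega))

/-- A path through the points `s i` can be rerouted through nearby points `q i` of `A`. -/
lemma exists_shortestPathLength_le_sum (hp : 1 < p) {κ : ℝ} (hκ : 1 < κ) :
    ∃ C : ℝ, 1 ≤ C ∧ ∀ (n : ℕ) (s q : ℕ → E) (A : Set E), q 0 = s 0 → q n = s n →
      (∀ i, 0 < i → i < n → q i ∈ A) →
      shortestPathLength p (s 0) (s n) A ≤
        κ * ∑ i ∈ Finset.range n, shortestPathLength p (s i) (s (i + 1)) A +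
          C * ∑ i ∈ Finset.range n, dist (s i) (q i) ^ p := by
  -- Both endpoints of each piece are moved, and each move costs a factor `κ'`.
  set κ' := √κ with hκ'
  have hκ1 : 1 < κ' := by rw [hκ']; exact Real.lt_sqrt_of_sq_lt (by simpa using hκ)
  have hκκ : κ' * κ' = κ := Real.mul_self_sqrt (by linarith)
  obtain ⟨C, hC1, hC⟩ := exists_add_rpow_le hp hκ1
  refine ⟨C + κ' * C, by nlinarith, fun n s q A h0 hn hq => ?_⟩
  rw [← h0, ← hn]
  refine (shortestPathLength_le_sum hp q n hq).trans ?_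
  have step : ∀ i, shortestPathLength p (q i) (q (i + 1)) A ≤
      κ * shortestPathLength p (s i) (s (i + 1)) A +
        (C * dist (s i) (q i) ^ p + κ' * C * dist (s (i + 1)) (q (i + 1)) ^ p) := by
    intro i
    have h1 := shortestPathLength_move_right hκ1.le hC1 hC hp (s i) (s (i + 1)) (q (i + 1)) A
    have h2 := shortestPathLength_move_right hκ1.le hC1 hC hp (q (i + 1)) (s i) (q i) A
    rw [shortestPathLength_comm, shortestPathLength_comm p (q (i + 1)) (s i)] at h2
    rw [← hκκ]
    nlinarith
  refine (Finset.sum_le_sum fun i _ => step i).trans ?_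
  rw [Finset.sum_add_distrib, Finset.sum_add_distrib, ← Finset.mul_sum, ← Finset.mul_sum,
    ← Finset.mul_sum, add_mul]
  -- The two sums differ by the terms at `0` and `n`, which vanish because the endpoints are not
  -- moved.
  have hshift : ∑ i ∈ Finset.range n, dist (s (i + 1)) (q (i + 1)) ^ p ≤
      ∑ i ∈ Finset.range n, dist (s i) (q i) ^ p := by
    have h1 := Finset.sum_range_succ (fun i => dist (s i) (q i) ^ p) n
    rw [Finset.sum_range_succ', h0, hn] at h1
    simp only [dist_self, Real.zero_rpow (by linarith : p ≠ 0), add_zero] at h1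
    exact h1.le
  gcongr

end Deterministic

/-! ### Random configurations, avoidance probabilities and measurability of path lengths. -/

section Configurations

/-- The subsets of `E`, with the σ-algebra generated by the events that a Borel set is avoided. -/
@[ext] structure Config (E : Type*) where
  /-- The set of points. -/
  points : Set E

/-- The event that the configuration has no point in `B`. -/
def avoidEvent {E : Type*} (B : Set E) : Set (Config E) := {A | Disjoint A.points B}

lemma mem_avoidEvent {E : Type*} {A : Config E} {B : Set E} :
    A ∈ avoidEvent B ↔ Disjoint A.points B := Iff.rfl

lemma notMem_avoidEvent {E : Type*} {A : Config E} {B : Set E} :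
    A ∉ avoidEvent B ↔ (A.points ∩ B).Nonempty := by
  rw [mem_avoidEvent, Set.not_disjoint_iff_nonempty_inter]

instance instMeasurableSpaceConfig {E : Type*} [MeasurableSpace E] : MeasurableSpace (Config E) :=
  MeasurableSpace.generateFrom (avoidEvent '' {B : Set E | MeasurableSet B})

lemma measurableSet_avoidEvent {E : Type*} [MeasurableSpace E] {B : Set E}
    (hB : MeasurableSet B) : MeasurableSet (avoidEvent B) :=
  MeasurableSpace.measurableSet_generateFrom ⟨B, hB, rfl⟩

lemma measurable_config {Ω E : Type*} [MeasurableSpace Ω] [MeasurableSpace E] {f : Ω → Config E}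
    (h : ∀ B : Set E, MeasurableSet B → MeasurableSet (f ⁻¹' avoidEvent B)) :
    Measurable f := by
  refine measurable_generateFrom ?_
  rintro _ ⟨B, hB, rfl⟩
  exact h B hB

/-- The configuration `A ∩ U`. -/
def Config.restrict {E : Type*} (U : Set E) (A : Config E) : Config E := ⟨A.points ∩ U⟩

/-- The image of the configuration `A` under `g`. -/
def Config.image {E F : Type*} (g : E → F) (A : Config E) : Config F := ⟨g '' A.points⟩

lemma preimage_restrict_avoidEvent {E : Type*} (U B : Set E) :
    Config.restrict U ⁻¹' avoidEvent B = avoidEvent (U ∩ B) := by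
  ext A
  simp only [Set.mem_preimage, mem_avoidEvent, Config.restrict]
  exact disjoint_assoc (α := Set E)

lemma preimage_image_avoidEvent {E F : Type*} (g : E → F) (B : Set F) :
    Config.image g ⁻¹' avoidEvent B = avoidEvent (g ⁻¹' B) := by
  ext A
  exact Set.disjoint_image_left

lemma measurable_restrict {E : Type*} [MeasurableSpace E] {U : Set E} (hU : MeasurableSet U) :
    Measurable (Config.restrict U) := by
  refine measurable_config fun B hB => ?_
  rw [preimage_restrict_avoidEvent]
  exact measurableSet_avoidEvent (hU.inter hB)

lemma measurable_image {E F : Type*} [MeasurableSpace E] [MeasurableSpace F] {g : E → F}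
    (hg : Measurable g) : Measurable (Config.image g) := by
  refine measurable_config fun B hB => ?_
  rw [preimage_image_avoidEvent]
  exact measurableSet_avoidEvent (hg hB)

/-- The avoidance events of the sets of finite measure. -/
def avoidEvents {E : Type*} [MeasurableSpace E] (ν : Measure E) : Set (Set (Config E)) :=
  avoidEvent '' {B : Set E | MeasurableSet B ∧ ν B ≠ ⊤}

lemma avoidEvent_inter {E : Type*} (B B' : Set E) :
    avoidEvent B ∩ avoidEvent B' = avoidEvent (B ∪ B') := by
  ext A; simp [avoidEvent, Set.disjoint_union_right]

lemma biInter_avoidEvent {ι : Type*} (S : Finset ι) (B : ι → Set E) :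
    ⋂ i ∈ S, avoidEvent (B i) = avoidEvent (⋃ i ∈ S, B i) := by
  ext A; simp [avoidEvent, Set.disjoint_iUnion_right]

lemma isPiSystem_avoidEvents {E : Type*} [MeasurableSpace E] (ν : Measure E) :
    IsPiSystem (avoidEvents ν) := by
  rintro _ ⟨B, ⟨hB, hνB⟩, rfl⟩ _ ⟨B', ⟨hB', hνB'⟩, rfl⟩ -
  exact ⟨B ∪ B', ⟨hB.union hB', measure_union_ne_top hνB hνB'⟩, (avoidEvent_inter B B').symm⟩

/-- Poisson laws prescribe avoidance probabilities only for sets of finite measure. These generate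
everything: avoiding `B` means avoiding each of its pieces in an exhaustion by sets of finite
measure. -/
lemma generateFrom_avoidEvents {E : Type*} [MeasurableSpace E] (ν : Measure E) [SigmaFinite ν] :
    instMeasurableSpaceConfig = MeasurableSpace.generateFrom (avoidEvents ν) := by
  refine le_antisymm (MeasurableSpace.generateFrom_le ?_) (MeasurableSpace.generateFrom_le ?_)
  · rintro _ ⟨B, hB, rfl⟩
    have : avoidEvent B = ⋂ n, avoidEvent (B ∩ spanningSets ν n) := by
      ext A
      simp only [Set.mem_iInter, mem_avoidEvent, ← Set.disjoint_iUnion_right, ← Set.inter_iUnion,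
        iUnion_spanningSets, Set.inter_univ]
    rw [this]
    refine @MeasurableSet.iInter _ _ (MeasurableSpace.generateFrom (avoidEvents ν)) _ _ fun n => ?_
    refine MeasurableSpace.measurableSet_generateFrom ⟨_, ⟨?_, ?_⟩, rfl⟩
    · exact MeasurableSet.inter hB (measurableSet_spanningSets ν n)
    · exact ((measure_mono Set.inter_subset_right).trans_lt (measure_spanningSets_lt_top ν n)).ne
  · rintro _ ⟨B, ⟨hB, -⟩, rfl⟩
    exact measurableSet_avoidEvent hB

/-- `Q` is the law of the Poisson process with intensity measure `ν`, in terms of its avoidance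
probabilities. -/
structure IsPoissonLaw {E : Type*} [MeasurableSpace E] (ν : Measure E) (Q : Measure (Config E)) :
    Prop where
  isProbabilityMeasure : IsProbabilityMeasure Q
  real_avoidEvent : ∀ B, MeasurableSet B → ν B ≠ ⊤ → Q.real (avoidEvent B) = Real.exp (-ν.real B)

section Law

variable {E : Type*} [MeasurableSpace E] {ν : Measure E} {Q Q' : Measure (Config E)}

/-- Avoiding two sets means avoiding their union, so avoidance events form a π-system and their
probabilities determine the law. -/
lemma IsPoissonLaw.unique [SigmaFinite ν] (h : IsPoissonLaw ν Q) (h' : IsPoissonLaw ν Q') :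
    Q = Q' := by
  have := h.isProbabilityMeasure
  have := h'.isProbabilityMeasure
  refine ext_of_generate_finite _ (generateFrom_avoidEvents ν) (isPiSystem_avoidEvents ν) ?_
    (by simp)
  rintro _ ⟨B, ⟨hB, hνB⟩, rfl⟩
  have := (h.real_avoidEvent B hB hνB).trans (h'.real_avoidEvent B hB hνB).symm
  simpa [measureReal_def, ENNReal.toReal_eq_toReal_iff'] using this

lemma IsPoissonLaw.map_image {F : Type*} [MeasurableSpace F] {ν' : Measure F} {g : E → F}
    (h : IsPoissonLaw ν Q) (hg : MeasurePreserving g ν ν') :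
    IsPoissonLaw ν' (Q.map (Config.image g)) := by
  have := h.isProbabilityMeasure
  refine ⟨Measure.isProbabilityMeasure_map (measurable_image hg.measurable).aemeasurable,
    fun B hB hνB => ?_⟩
  rw [map_measureReal_apply (measurable_image hg.measurable) (measurableSet_avoidEvent hB),
    preimage_image_avoidEvent, h.real_avoidEvent _ (hg.measurable hB), measureReal_def,
    measureReal_def, hg.measure_preimage hB.nullMeasurableSet]
  rwa [hg.measure_preimage hB.nullMeasurableSet]

lemma IsPoissonLaw.integral_image [SigmaFinite ν] {g : E → E} (h : IsPoissonLaw ν Q)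
    (hg : MeasurePreserving g ν ν) {f : Config E → ℝ} (hf : Measurable f) :
    ∫ A, f (Config.image g A) ∂Q = ∫ A, f A ∂Q := by
  conv_rhs => rw [h.unique (h.map_image hg)]
  rw [integral_map (measurable_image hg.measurable).aemeasurable hf.aestronglyMeasurable]

/-- The restrictions of a Poisson process to disjoint sets are independent. -/
lemma IsPoissonLaw.iIndepFun_restrict [SigmaFinite ν] (h : IsPoissonLaw ν Q) {ι : Type*}
    {U : ι → Set E} (hU : ∀ i, MeasurableSet (U i)) (hd : Pairwise (Function.onFun Disjoint U)) :
    iIndepFun (fun i => Config.restrict (U i)) Q := by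
  have := h.isProbabilityMeasure
  rw [iIndepFun_iff_iIndep]
  refine iIndepSets.iIndep (fun i => (measurable_restrict (hU i)).comap_le)
    (fun i => Set.preimage (Config.restrict (U i)) '' avoidEvents ν) (fun i => ?_) (fun i => ?_) ?_
  · exact (isPiSystem_avoidEvents ν).comap _
  · conv_lhs => rw [generateFrom_avoidEvents ν]
    exact MeasurableSpace.comap_generateFrom
  · rw [iIndepSets_iff]
    intro S f hf
    choose! s hs hs' using hf
    choose! B hB hB' using hs
    have hfi : ∀ i ∈ S, f i = avoidEvent (U i ∩ B i) := fun i hi => by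
      rw [← preimage_restrict_avoidEvent, hB' i hi, hs' i hi]
    have hm : ∀ i ∈ S, MeasurableSet (U i ∩ B i) := fun i hi => (hU i).inter (hB i hi).1
    have ht : ∀ i ∈ S, ν (U i ∩ B i) ≠ ⊤ := fun i hi =>
      ((measure_mono Set.inter_subset_right).trans_lt (hB i hi).2.lt_top).ne
    -- Joint avoidance is avoidance of a disjoint union; the exponential turns additivity of `ν`
    -- into a product.
    have hreal : Q.real (⋂ i ∈ S, f i) = ∏ i ∈ S, Q.real (f i) := by
      rw [Set.iInter₂_congr hfi, biInter_avoidEvent, h.real_avoidEvent,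
        measureReal_biUnion_finset _ hm ht, ← Finset.sum_neg_distrib, Real.exp_sum]
      · exact Finset.prod_congr rfl fun i hi => by
          rw [hfi i hi, h.real_avoidEvent _ (hm i hi) (ht i hi)]
      · intro i _ j _ hij
        exact (hd hij).mono Set.inter_subset_left Set.inter_subset_left
      · exact S.measurableSet_biUnion hm
      · exact (measure_biUnion_lt_top S.finite_toSet fun i hi => (ht i hi).lt_top).ne
    simp only [measureReal_def, ← ENNReal.toReal_prod] at hreal
    rwa [ENNReal.toReal_eq_toReal_iff' (measure_ne_top _ _)
      (ENNReal.prod_ne_top fun _ _ => measure_ne_top _ _)] at hreal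

end Law

section PathMeasurability

variable {E : Type*} [PseudoMetricSpace E]

lemma exists_pathCost_lt {p c : ℝ} (hp : 0 ≤ p) {k : ℕ} {π : ℕ → E} (h : pathCost p k π < c) :
    ∃ ε > 0, ∀ π' : ℕ → E, (∀ i : Fin (k + 1), dist (π' i) (π i) < ε) → pathCost p k π' < c := by
  set f : (Fin (k + 1) → E) → ℝ := fun v => ∑ i : Fin k, dist (v i.castSucc) (v i.succ) ^ p
  have hf : Continuous f := by
    refine continuous_finsetSum _ fun i _ => ?_
    exact ((continuous_apply _).dist (continuous_apply _)).rpow_const fun _ => Or.inr hp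
  have hfπ : ∀ π : ℕ → E, f (fun i => π i) = pathCost p k π := fun π => by
    simp [f, pathCost, Finset.sum_range]
  obtain ⟨ε, hε, h'⟩ := Metric.isOpen_iff.1 (isOpen_Iio.preimage hf) (fun i => π i)
    (show f (fun i => π i) < c by rwa [hfπ])
  refine ⟨ε, hε, fun π' hπ' => ?_⟩
  have : f (fun i => π' i) < c := @h' (fun i => π' i) ((dist_pi_lt_iff hε).2 hπ')
  rwa [hfπ] at this

/-- The cost is continuous in the finitely many vertices, so each vertex may be replaced by a small
ball around a point of a countable dense set. Thus `{L < c}` is a countable union of events that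
finitely many balls are hit. -/
lemma measurable_shortestPathLength [MeasurableSpace E] [OpensMeasurableSpace E]
    [TopologicalSpace.SeparableSpace E] {p : ℝ} (hp : 0 ≤ p)
    (x y : E) : Measurable fun A : Config E => shortestPathLength p x y A.points := by
  have : Nonempty E := ⟨x⟩
  refine measurable_of_Iio fun c => ?_
  set D := TopologicalSpace.denseSeq E
  have hset : (fun A : Config E => shortestPathLength p x y A.points) ⁻¹' Set.Iio c =
      ⋃ (k : ℕ) (n : ℕ) (r : Fin (k + 1) → ℕ), {A : Config E |
        -- For `k = 0` one vertex is both endpoints, and closeness to a common ball centre would not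
        -- force `x = y`.
        ((k = 0 → x = y) ∧ dist x (D (r 0)) < 1 / (n + 1) ∧ dist y (D (r (Fin.last k))) < 1 / (n + 1) ∧
          ∀ π : ℕ → E, (∀ i : Fin (k + 1), dist (π i) (D (r i)) < 1 / (n + 1)) →
            pathCost p k π < c) ∧
        ∀ i : Fin (k + 1),
          ((A.points ∪ {x, y}) ∩ Metric.ball (D (r i)) (1 / (n + 1))).Nonempty} := by
    ext A
    simp only [Set.mem_preimage, Set.mem_Iio, shortestPathLength_lt_iff, Set.mem_iUnion,
      Set.mem_ofPred_eq]
    constructor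
    · rintro ⟨k, π, h0, hk, hA, hc⟩
      obtain ⟨ε, hε, h⟩ := exists_pathCost_lt hp hc
      obtain ⟨n, hn⟩ := exists_nat_one_div_lt (half_pos hε)
      have hn0 : (0 : ℝ) < 1 / (n + 1) := by positivity
      have hr : ∀ i : Fin (k + 1), ∃ j, dist (π i) (D j) < 1 / (n + 1) := fun i =>
        (TopologicalSpace.denseRange_denseSeq E).exists_dist_lt (π i) hn0
      choose r hr using hr
      refine ⟨k, n, r, ⟨fun hk0 => by subst hk0; rw [← h0, hk], by simpa [h0] using hr 0, by simpa [hk] using hr (Fin.last k),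
        fun π' hπ' => h π' fun i => ?_⟩, fun i => ⟨π i, hA i (by omega), hr i⟩⟩
      have := dist_triangle_right (π' i) (π i) (D (r i))
      have := hπ' i
      have := hr i
      linarith
    · rintro ⟨k, n, r, ⟨h0, hx, hy, h⟩, hA⟩
      choose v hv hv' using hA
      set π : ℕ → E := fun i => if i = 0 then x else if i = k then y else
        if hi : i < k + 1 then v ⟨i, hi⟩ else x with hπ
      refine ⟨k, π, by simp [hπ], ?_, fun i hi => ?_, h π fun i => ?_⟩
      · rcases Nat.eq_zero_or_pos k with hk | hk
        · simpa [hπ, hk] using h0 hk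
        · simp [hπ, hk.ne']
      · simp only [hπ]
        split_ifs with h1 h2 h3
        · simp
        · simp
        · exact hv _
        · simp
      · simp only [hπ]
        split_ifs with h1 h2 h3
        · rwa [show i = 0 from Fin.ext h1]
        · rwa [show i = Fin.last k from Fin.ext h2]
        · exact hv' _
        · omega
  rw [hset]
  refine .iUnion fun k => .iUnion fun n => .iUnion fun r => ?_
  rw [Set.ofPred_and, Set.ofPred_forall]
  refine (MeasurableSet.const _).inter ?_
  refine .iInter fun i => ?_
  -- A ball containing `x` or `y` imposes no condition on the configuration.
  by_cases hxy : x ∈ Metric.ball (D (r i)) (1 / ((n : ℝ) + 1)) ∨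
    y ∈ Metric.ball (D (r i)) (1 / ((n : ℝ) + 1))
  · convert MeasurableSet.univ
    refine Set.eq_univ_of_forall fun A => ?_
    rcases hxy with h | h
    · exact ⟨x, by simp, h⟩
    · exact ⟨y, by simp, h⟩
  · convert! (measurableSet_avoidEvent (Metric.isOpen_ball
      (x := D (r i)) (ε := 1 / ((n : ℝ) + 1))).measurableSet).compl using 1
    ext A
    simp only [Set.mem_compl_iff, notMem_avoidEvent, Set.mem_ofPred_eq, Set.union_inter_distrib_right]
    have : ({x, y} : Set E) ∩ Metric.ball (D (r i)) (1 / ((n : ℝ) + 1)) = ∅ := by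
      rw [Set.eq_empty_iff_forall_notMem]
      rintro z ⟨rfl | rfl, hz⟩
      · exact hxy (Or.inl hz)
      · exact hxy (Or.inr hz)
    rw [this, Set.union_empty]

end PathMeasurability

end Configurations

/-! ### Truncated distance to the nearest point of the configuration. -/

section HitRadius

variable {E : Type*} [PseudoMetricSpace E] {n j : ℕ} {s : E} {A : Set E}

/-- The least natural number `k` such that `A` meets the ball of radius `k` around `s`,
truncated at `n`. -/
noncomputable def hitRadius (n : ℕ) (s : E) (A : Set E) : ℕ :=
  sInf {k : ℕ | n ≤ k ∨ (A ∩ Metric.ball s k).Nonempty}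

lemma hitRadius_mem (n : ℕ) (s : E) (A : Set E) :
    n ≤ hitRadius n s A ∨ (A ∩ Metric.ball s (hitRadius n s A)).Nonempty :=
  Nat.sInf_mem (s := {k : ℕ | n ≤ k ∨ (A ∩ Metric.ball s k).Nonempty}) ⟨n, Or.inl le_rfl⟩

lemma hitRadius_le (n : ℕ) (s : E) (A : Set E) : hitRadius n s A ≤ n :=
  Nat.sInf_le (Or.inl le_rfl)

lemma lt_hitRadius_iff : j < hitRadius n s A ↔ j < n ∧ Disjoint A (Metric.ball s j) := by
  constructor
  · intro h
    have := Nat.notMem_of_lt_sInf h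
    simpa [Set.not_nonempty_iff_eq_empty, Set.disjoint_iff_inter_eq_empty] using this
  · rintro ⟨h1, h2⟩
    by_contra! h
    rcases hitRadius_mem n s A with h' | ⟨q, hq, hq'⟩
    · omega
    · exact Set.disjoint_left.1 h2 hq (Metric.ball_subset_ball (by exact_mod_cast h) hq')

/-- Truncation makes the hitting radius local, which the independence of distant blocks requires. -/
lemma hitRadius_inter {U : Set E} (hU : Metric.ball s n ⊆ U) :
    hitRadius n s (A ∩ U) = hitRadius n s A := by
  refine eq_of_forall_lt_iff fun j => ?_
  rw [lt_hitRadius_iff, lt_hitRadius_iff]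
  refine and_congr_right fun hj => ?_
  have : Metric.ball s j ⊆ U := (Metric.ball_subset_ball (by exact_mod_cast hj.le)).trans hU
  rw [Set.disjoint_iff_inter_eq_empty, Set.disjoint_iff_inter_eq_empty, Set.inter_assoc,
    Set.inter_eq_right.2 this]

lemma hitRadius_eq (h : Disjoint A (Metric.ball s n)) : hitRadius n s A = n := by
  refine (hitRadius_le n s A).antisymm (le_of_forall_lt fun j hj => lt_hitRadius_iff.2 ⟨hj, ?_⟩)
  exact h.mono_right (Metric.ball_subset_ball (by exact_mod_cast hj.le))

lemma exists_dist_lt_hitRadius (h : ¬ Disjoint A (Metric.ball s n)) :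
    ∃ q ∈ A, dist s q < hitRadius n s A := by
  have : (A ∩ Metric.ball s (hitRadius n s A)).Nonempty := by
    rcases hitRadius_mem n s A with h' | h'
    · rw [(hitRadius_le n s A).antisymm h']
      rwa [Set.not_disjoint_iff_nonempty_inter] at h
    · exact h'
  obtain ⟨q, hq, hq'⟩ := this
  exact ⟨q, hq, by rwa [dist_comm]⟩

lemma measurable_hitRadius [MeasurableSpace E] [OpensMeasurableSpace E] (n : ℕ) (s : E) :
    Measurable fun A : Config E => hitRadius n s A.points := by
  refine measurable_of_Ioi fun j => ?_
  have : (fun A : Config E => hitRadius n s A.points) ⁻¹' Set.Ioi j =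
      {_A | j < n} ∩ avoidEvent (Metric.ball s j) := by
    ext A; simp [lt_hitRadius_iff, mem_avoidEvent]
  rw [this]
  exact (MeasurableSet.const _).inter (measurableSet_avoidEvent Metric.isOpen_ball.measurableSet)

lemma measurable_hitRadius_rpow [MeasurableSpace E] [OpensMeasurableSpace E] (n : ℕ) (s : E)
    (p : ℝ) : Measurable fun A : Config E => (hitRadius n s A.points : ℝ) ^ p :=
  ((measurable_from_top (f := fun k : ℕ => (k : ℝ))).comp (measurable_hitRadius n s)).pow_const p

lemma integrable_hitRadius_rpow [MeasurableSpace E] [OpensMeasurableSpace E]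
    {Q : Measure (Config E)} [IsFiniteMeasure Q] {p : ℝ} (hp : 1 < p) (n : ℕ) (s : E) :
    Integrable (fun A : Config E => (hitRadius n s A.points : ℝ) ^ p) Q :=
  Integrable.of_bound (measurable_hitRadius_rpow n s p).aestronglyMeasurable
    ((n : ℝ) ^ p) (.of_forall fun A => by
      rw [Real.norm_of_nonneg (by positivity)]
      exact Real.rpow_le_rpow (by positivity) (by exact_mod_cast hitRadius_le _ _ _) (by linarith))

/-- If the hitting radius is `j + 1`, the ball of radius `j` is avoided and the term `k = j` alone
suffices. Integrated, this bounds moments by avoidance probabilities. -/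
lemma hitRadius_rpow_le {p : ℝ} (hp : 0 < p) : (hitRadius n s A : ℝ) ^ p ≤
    ∑ k ∈ Finset.range n, (k + 1 : ℝ) ^ p *
      Set.indicator (avoidEvent (Metric.ball s k)) (fun _ => (1 : ℝ)) ⟨A⟩ := by
  have hnn : ∀ k ∈ Finset.range n, 0 ≤ (k + 1 : ℝ) ^ p *
      Set.indicator (avoidEvent (Metric.ball s k)) (fun _ => (1 : ℝ)) ⟨A⟩ := fun k _ =>
    mul_nonneg (by positivity) (Set.indicator_nonneg (fun _ _ => zero_le_one) _)
  rcases hh : hitRadius n s A with _ | j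
  · rw [Nat.cast_zero, Real.zero_rpow hp.ne']
    exact Finset.sum_nonneg hnn
  · have hj := lt_hitRadius_iff.1 (show j < hitRadius n s A by omega)
    refine le_trans ?_ (Finset.single_le_sum hnn (Finset.mem_range.2 hj.1))
    rw [Set.indicator_of_mem (show (⟨A⟩ : Config E) ∈ _ from hj.2)]
    simp

end HitRadius

/-! ### Scaling of path lengths under similarities. -/

section Similarity

variable {E F : Type*} [PseudoMetricSpace E] [PseudoMetricSpace F]

lemma shortestPathLength_image {p r : ℝ} (hp : 1 < p) (hr : 0 < r) {g : E → F}
    (hg : ∀ a b, dist (g a) (g b) = r * dist a b) (x y : E) (A : Set E) :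
    shortestPathLength p (g x) (g y) (g '' A) = r ^ p * shortestPathLength p x y A := by
  have hrp : 0 < r ^ p := Real.rpow_pos_of_pos hr p
  have hcost : ∀ (k : ℕ) (π : ℕ → E), pathCost p k (fun i => g (π i)) = r ^ p * pathCost p k π := by
    intro k π
    simp only [pathCost, Finset.mul_sum, hg, Real.mul_rpow hr.le dist_nonneg]
  refine le_antisymm ?_ (le_shortestPathLength fun k π h0 hk hA => ?_)
  · rw [← div_le_iff₀' hrp]
    refine le_shortestPathLength fun k π h0 hk hA => ?_
    rw [div_le_iff₀' hrp, ← hcost]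
    refine shortestPathLength_le_pathCost (by rw [h0]) (by rw [hk]) fun i hi => ?_
    rcases hA i hi with h | h | h
    · exact Or.inl ⟨_, h, rfl⟩
    · exact Or.inr (Or.inl (by rw [h]))
    · exact Or.inr (Or.inr (by rw [Set.mem_singleton_iff.1 h]; rfl))
  -- A path without edges in the image forces `dist x y = 0`, and then the direct path costs
  -- nothing.
  · rcases Nat.eq_zero_or_pos k with rfl | hk0
    · have h1 := shortestPathLength_le_dist p x y A
      have h2 : dist (g x) (g y) = 0 := by rw [← h0, ← hk, dist_self]
      rw [hg] at h2
      rw [(mul_eq_zero.1 h2).resolve_left hr.ne', Real.zero_rpow (by linarith)] at h1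
      have := mul_le_mul_of_nonneg_left h1 hrp.le
      simpa [pathCost] using this
    -- Vertices are lifted one by one; the lifts at `0` and `k` are pinned to `x` and `y`, since `g`
    -- need not be injective.
    · have hex : ∀ i, ∃ v, i ≤ k → v ∈ A ∪ {x, y} ∧ g v = π i ∧ (i = 0 → v = x) ∧
          (i = k → v = y) := by
        intro i
        by_cases hi : i ≤ k
        · rcases Nat.eq_zero_or_pos i with rfl | hi0
          · exact ⟨x, fun _ => ⟨by simp, h0.symm, fun _ => rfl, by omega⟩⟩
          by_cases hik : i = k
          · exact ⟨y, fun _ => ⟨by simp, by rw [hik, hk], by omega, fun _ => rfl⟩⟩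
          rcases hA i hi with ⟨v, hv, hv'⟩ | h | h
          · exact ⟨v, fun _ => ⟨Or.inl hv, hv', by omega, by omega⟩⟩
          · exact ⟨x, fun _ => ⟨by simp, h.symm, by omega, by omega⟩⟩
          · exact ⟨y, fun _ => ⟨by simp, h.symm, by omega, by omega⟩⟩
        · exact ⟨x, by omega⟩
      choose v hv using hex
      have hc : pathCost p k π = r ^ p * pathCost p k v := by
        rw [← hcost]
        refine Finset.sum_congr rfl fun i hi => ?_
        have := Finset.mem_range.1 hi
        dsimp only
        rw [(hv i (by omega)).2.1, (hv (i + 1) (by omega)).2.1]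
      rw [hc]
      refine mul_le_mul_of_nonneg_left ?_ hrp.le
      exact shortestPathLength_le_pathCost ((hv 0 (by omega)).2.2.1 rfl)
        ((hv k le_rfl).2.2.2 rfl) fun i hi => (hv i hi).1

end Similarity

lemma real_unitBall_pos {E : Type*} [NormedAddCommGroup E] [NormedSpace ℝ E]
    [FiniteDimensional ℝ E] [MeasurableSpace E] (ν : Measure E) [ν.IsAddHaarMeasure] :
    0 < ν.real (Metric.ball (0 : E) 1) :=
  ENNReal.toReal_pos (Metric.measure_ball_pos ν 0 one_pos).ne' measure_ball_lt_top.ne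

/-! ### Moments of the hitting radius, translation invariance and truncation of means. -/

section Means

variable {E : Type*} [NormedAddCommGroup E] [NormedSpace ℝ E] [FiniteDimensional ℝ E]
  [MeasurableSpace E] [BorelSpace E] {ν : Measure E} [ν.IsAddHaarMeasure] {Q : Measure (Config E)}

lemma IsPoissonLaw.real_avoidEvent_ball [Nontrivial E] (h : IsPoissonLaw ν Q) (s : E) {r : ℝ} (hr : 0 ≤ r) :
    Q.real (avoidEvent (Metric.ball s r)) =
      Real.exp (-(r ^ Module.finrank ℝ E * ν.real (Metric.ball 0 1))) := by
  rw [h.real_avoidEvent _ Metric.isOpen_ball.measurableSet measure_ball_lt_top.ne,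
    measureReal_def, Measure.addHaar_ball ν s hr, ENNReal.toReal_mul,
    ENNReal.toReal_ofReal (by positivity), measureReal_def]

lemma summable_rpow_mul_exp (p : ℝ) {v : ℝ} (hv : 0 < v) :
    Summable fun k : ℕ => (k + 1 : ℝ) ^ p * Real.exp (-(k * v)) := by
  have h := (summable_nat_add_iff 1).2 (Real.summable_pow_mul_exp_neg_nat_mul ⌈p⌉₊ hv)
  refine (h.mul_left (Real.exp v)).of_nonneg_of_le (fun k => by positivity) fun k => ?_
  have h1 : (k + 1 : ℝ) ^ p ≤ (k + 1 : ℝ) ^ ⌈p⌉₊ := by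
    rw [← Real.rpow_natCast]
    exact Real.rpow_le_rpow_of_exponent_le (by linarith [(Nat.cast_nonneg k : (0 : ℝ) ≤ k)])
      (Nat.le_ceil p)
  have h2 : Real.exp v * Real.exp (-v * ((k + 1 : ℕ) : ℝ)) = Real.exp (-(k * v)) := by
    rw [← Real.exp_add]; congr 1; push_cast; ring
  calc (k + 1 : ℝ) ^ p * Real.exp (-(k * v)) ≤ (k + 1 : ℝ) ^ ⌈p⌉₊ * Real.exp (-(k * v)) := by gcongr
    _ = _ := by rw [← h2]; push_cast; ring

/-- The distance to the nearest point of a Poisson process has uniformly bounded moments. -/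
lemma IsPoissonLaw.exists_integral_hitRadius_le [Nontrivial E] (h : IsPoissonLaw ν Q) {p : ℝ}
    (hp : 0 < p) :
    ∃ K : ℝ, 0 ≤ K ∧ ∀ n s, ∫ A, (hitRadius n s A.points : ℝ) ^ p ∂Q ≤ K := by
  have := h.isProbabilityMeasure
  set v := ν.real (Metric.ball (0 : E) 1)
  have hv : 0 < v := real_unitBall_pos ν
  have hsum := summable_rpow_mul_exp p hv
  refine ⟨∑' k : ℕ, (k + 1 : ℝ) ^ p * Real.exp (-(k * v)), tsum_nonneg fun k => by positivity,
    fun n s => ?_⟩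
  have hm : ∀ k : ℕ, MeasurableSet (avoidEvent (Metric.ball s (k : ℝ))) := fun k =>
    measurableSet_avoidEvent Metric.isOpen_ball.measurableSet
  have hi : ∀ k ∈ Finset.range n, Integrable (fun A : Config E => (k + 1 : ℝ) ^ p *
      Set.indicator (avoidEvent (Metric.ball s k)) (fun _ => (1 : ℝ)) A) Q := fun k _ =>
    ((integrable_const 1).indicator (hm k)).const_mul _
  calc ∫ A, (hitRadius n s A.points : ℝ) ^ p ∂Q
      ≤ ∫ A, ∑ k ∈ Finset.range n, (k + 1 : ℝ) ^ p *
          Set.indicator (avoidEvent (Metric.ball s k)) (fun _ => (1 : ℝ)) A ∂Q :=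
        integral_mono_of_nonneg (.of_forall fun A => by positivity) (integrable_finsetSum _ hi)
          (.of_forall fun A => hitRadius_rpow_le hp)
    _ = ∑ k ∈ Finset.range n, (k + 1 : ℝ) ^ p * Q.real (avoidEvent (Metric.ball s k)) := by
        rw [integral_finsetSum _ hi]
        refine Finset.sum_congr rfl fun k _ => ?_
        rw [integral_const_mul, integral_indicator_const _ (hm k), smul_eq_mul, mul_one]
    _ ≤ ∑ k ∈ Finset.range n, (k + 1 : ℝ) ^ p * Real.exp (-(k * v)) := by
        refine Finset.sum_le_sum fun k _ => mul_le_mul_of_nonneg_left ?_ (by positivity)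
        rw [h.real_avoidEvent_ball s (Nat.cast_nonneg k), Real.exp_le_exp, neg_le_neg_iff]
        refine mul_le_mul_of_nonneg_right ?_ hv.le
        -- Since the dimension is at least one, `k` is at most its power, so exponential decay in
        -- `k` suffices in every dimension.
        exact_mod_cast Nat.le_self_pow Module.finrank_pos.ne' k
    _ ≤ _ := hsum.sum_le_tsum _ fun k _ => by positivity

variable {p : ℝ}

lemma measurable_shortestPathLength_inter (hp : 1 < p) (x y : E) {U : Set E}
    (hU : MeasurableSet U) :
    Measurable fun A : Config E => shortestPathLength p x y (A.points ∩ U) :=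
  (measurable_shortestPathLength (by linarith) x y).comp (measurable_restrict hU)

lemma integrable_shortestPathLength_inter [IsFiniteMeasure Q] (hp : 1 < p) (x y : E) {U : Set E}
    (hU : MeasurableSet U) :
    Integrable (fun A : Config E => shortestPathLength p x y (A.points ∩ U)) Q :=
  Integrable.of_bound (measurable_shortestPathLength_inter hp x y hU).aestronglyMeasurable
    (dist x y ^ p) (.of_forall fun A => by
      rw [Real.norm_of_nonneg (shortestPathLength_nonneg _ _ _ _)]
      exact shortestPathLength_le_dist _ _ _ _)

lemma IsPoissonLaw.integral_translate (h : IsPoissonLaw ν Q) (hp : 1 < p) (s v : E) (R : ℝ) :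
    ∫ A, shortestPathLength p s (s + v) (A.points ∩ Metric.ball s R) ∂Q =
      ∫ A, shortestPathLength p 0 v (A.points ∩ Metric.ball 0 R) ∂Q := by
  rw [← h.integral_image (measurePreserving_add_right ν s)
    (measurable_shortestPathLength_inter hp s (s + v) Metric.isOpen_ball.measurableSet)]
  refine integral_congr_ae (.of_forall fun A => ?_)
  have := shortestPathLength_image hp one_pos (g := fun a : E => a + s) (by simp) 0 v
    (A.points ∩ Metric.ball 0 R)
  rw [Real.one_rpow, one_mul, Set.image_inter (add_left_injective s)] at this
  simpa [Config.image, add_comm v s] using this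

/-- A nearly optimal path has finitely many vertices, so it lies in a large ball; the direct path
gives domination. -/
lemma tendsto_integral_ball [IsProbabilityMeasure Q] (hp : 1 < p) (x y : E) :
    Tendsto (fun n : ℕ => ∫ A, shortestPathLength p x y (A.points ∩ Metric.ball 0 n) ∂Q) atTop
      (𝓝 (∫ A, shortestPathLength p x y A.points ∂Q)) := by
  refine tendsto_integral_of_dominated_convergence (fun _ => dist x y ^ p)
    (fun n => (measurable_shortestPathLength_inter hp x y
      Metric.isOpen_ball.measurableSet).aestronglyMeasurable) (integrable_const _)
    (fun n => .of_forall fun A => ?_) (.of_forall fun A => ?_)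
  · rw [Real.norm_of_nonneg (shortestPathLength_nonneg _ _ _ _)]
    exact shortestPathLength_le_dist _ _ _ _
  · refine tendsto_order.2 ⟨fun c hc => .of_forall fun n =>
      hc.trans_le (shortestPathLength_anti Set.inter_subset_left), fun c hc => ?_⟩
    obtain ⟨k, π, h0, hk, hA, hcost⟩ := shortestPathLength_lt_iff.1 hc
    have hb : ∀ᶠ n : ℕ in atTop, ∀ i ∈ Finset.range (k + 1), ‖π i‖ < n :=
      (Finset.eventually_all _).2 fun i _ =>
        tendsto_natCast_atTop_atTop.eventually_gt_atTop _
    filter_upwards [hb] with n hn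
    refine (shortestPathLength_le_pathCost h0 hk fun i hi => ?_).trans_lt hcost
    rcases hA i hi with h | h
    · exact Or.inl ⟨h, by simpa using hn i (by simpa using Nat.lt_succ_of_le hi)⟩
    · exact Or.inr h

end Means

/-! ### Convergence of almost subadditive functions. -/

section Limit

/-- A limit criterion for almost subadditive functions. -/
lemma exists_tendsto_div_of_almost_subadditive {a b : ℝ → ℝ} {p : ℝ}
    (ha : ∀ t, 0 ≤ a t) (hab : ∀ t, a t ≤ b t)
    (h : ∀ κ : ℝ, 1 < κ → ∃ K : ℝ, ∀ M : ℝ, 1 ≤ M → ∀ᶠ m in atTop,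
      b m / m ≤ κ * (a M / M) + K / M + κ * M ^ p / m) :
    ∃ C : ℝ, Tendsto (fun t => a t / t) atTop (𝓝 C) ∧ Tendsto (fun t => b t / t) atTop (𝓝 C) := by
  have hdiv : ∀ c : ℝ, Tendsto (fun t : ℝ => c / t) atTop (𝓝 0) := fun c =>
    tendsto_const_nhds.div_atTop tendsto_id
  have hpos : ∀ᶠ t : ℝ in atTop, 1 ≤ t := eventually_ge_atTop 1
  have hab' : ∀ᶠ t in atTop, a t / t ≤ b t / t := by
    filter_upwards [hpos] with t ht
    exact div_le_div_of_nonneg_right (hab t) (by linarith)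
  have hlow : ∀ᶠ t in atTop, 0 ≤ a t / t := by
    filter_upwards [hpos] with t ht
    exact div_nonneg (ha t) (by linarith)
  -- The case `κ = 2`, `M = 1` bounds the ratio, so that its real `liminf` is meaningful.
  obtain ⟨K₀, hK₀⟩ := h 2 (by norm_num)
  have hup : ∃ B, ∀ᶠ t in atTop, a t / t ≤ B := by
    refine ⟨2 * (a 1 / 1) + K₀ / 1 + 1, ?_⟩
    filter_upwards [hK₀ 1 le_rfl, hab', (hdiv (2 * 1 ^ p)).eventually_lt_const one_pos]
      with t h1 h2 h3
    linarith
  have hbdd : IsBoundedUnder (· ≥ ·) atTop (fun t => a t / t) := isBoundedUnder_of_eventually_ge hlow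
  have hbdd' : IsBoundedUnder (· ≤ ·) atTop (fun t => a t / t) :=
    isBoundedUnder_of_eventually_le hup.choose_spec
  set C := liminf (fun t => a t / t) atTop with hC
  have hC0 : 0 ≤ C := le_liminf_of_le hbdd'.isCoboundedUnder_ge hlow
  have key : ∀ c, C < c → ∀ᶠ m in atTop, b m / m < c := by
    intro c hc
    set η := (c - C) / 4 with hη
    have hη0 : 0 < η := by rw [hη]; linarith
    set κ := 1 + η / (C + η) with hκ
    have hCη : 0 < C + η := by linarith
    have hκ1 : 1 < κ := by rw [hκ]; linarith [div_pos hη0 hCη]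
    have hκC : κ * (C + η) = C + 2 * η := by rw [hκ]; field_simp; ring
    obtain ⟨K, hK⟩ := h κ hκ1
    have hfreq : ∃ᶠ M in atTop, a M / M < C + η :=
      frequently_lt_of_liminf_lt hbdd'.isCoboundedUnder_ge (by linarith)
    -- A large `M` nearly attaining the `liminf`; with `κ (C + η) = C + 2 η`, letting `m` grow puts
    -- `b m / m` below `C + 4 η`.
    obtain ⟨M, hM, hM1, hMK⟩ :=
      (hfreq.and_eventually (hpos.and ((hdiv K).eventually_lt_const hη0))).exists
    filter_upwards [hK M hM1, (hdiv (κ * M ^ p)).eventually_lt_const hη0] with m h1 h2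
    have : κ * (a M / M) ≤ κ * (C + η) := mul_le_mul_of_nonneg_left hM.le (by linarith)
    have : c = C + 4 * η := by rw [hη]; ring
    linarith
  have key' : ∀ c, c < C → ∀ᶠ m in atTop, c < a m / m := fun c hc =>
    eventually_lt_of_lt_liminf hc hbdd
  refine ⟨C, tendsto_order.2 ⟨key', fun c hc => ?_⟩, tendsto_order.2 ⟨fun c hc => ?_, key⟩⟩
  · filter_upwards [key c hc, hab'] with m h1 h2 using h2.trans_lt h1
  · filter_upwards [key' c hc, hab'] with m h1 h2 using h1.trans_le h2

end Limit

/-! ### Existence of the limiting constant. -/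

section MeanBound

variable {E : Type*} [NormedAddCommGroup E] [NormedSpace ℝ E]

/-- The segment is cut into blocks of length `M` and a remainder shorter than `M`, and the cut
points are replaced by nearby points of `A`, all within `2m` of the origin. -/
lemma shortestPathLength_inter_ball_le {p κ C : ℝ} (hp : 1 < p) (hκ : 1 < κ) (hC1 : 1 ≤ C)
    (hC : ∀ (n : ℕ) (s q : ℕ → E) (A : Set E), q 0 = s 0 → q n = s n →
      (∀ i, 0 < i → i < n → q i ∈ A) →
      shortestPathLength p (s 0) (s n) A ≤
        κ * ∑ i ∈ Finset.range n, shortestPathLength p (s i) (s (i + 1)) A +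
          C * ∑ i ∈ Finset.range n, dist (s i) (q i) ^ p)
    {e : E} (he : ‖e‖ = 1) {M R m : ℝ} (hM : 0 < M) (hm1 : 1 ≤ m) (hRm : R ≤ m)
    (A : Set E) :
    shortestPathLength p 0 (m • e) (A ∩ Metric.ball 0 (2 * m)) ≤
      κ * (∑ i ∈ Finset.range ⌊m / M⌋₊, shortestPathLength p ((i * M) • e)
        ((i * M) • e + M • e) (A ∩ Metric.ball ((i * M) • e) R) + M ^ p) +
      (C + 2 ^ p) * ∑ i ∈ Finset.range (⌊m / M⌋₊ + 1),
        (hitRadius ⌊m⌋₊ ((i * M) • e) A : ℝ) ^ p := by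
  set n := ⌊m / M⌋₊ with hn
  have hnM : n * M ≤ m := by
    rw [← le_div_iff₀ hM]; exact Nat.floor_le (by positivity)
  have hnM' : m < (n + 1) * M := by rw [← div_lt_iff₀ hM]; exact Nat.lt_floor_add_one _
  set N := ⌊m⌋₊ with hN
  have hNm : (N : ℝ) ≤ m := Nat.floor_le (by linarith)
  have hN1 : (1 : ℝ) ≤ N := by exact_mod_cast (Nat.one_le_floor_iff m).2 hm1
  have hNm' : m ≤ 2 * N := by have := Nat.lt_floor_add_one m; rw [← hN] at this; linarith
  have h2p : (0 : ℝ) < 2 ^ p := by positivity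
  have hsum1 : 0 ≤ ∑ i ∈ Finset.range n, shortestPathLength p ((i * M) • e)
        ((i * M) • e + M • e) (A ∩ Metric.ball ((i * M) • e) R) + M ^ p :=
    add_nonneg (Finset.sum_nonneg fun i _ => shortestPathLength_nonneg _ _ _ _) (by positivity)
  -- If some ball of radius `⌊m⌋` is empty, its hitting radius is `⌊m⌋ ≥ m/2`, which pays for the
  -- direct jump of cost `m^p`; hence the extra `2^p` in the constant.
  by_cases hvoid : ∃ i ≤ n, Disjoint A (Metric.ball ((i * M) • e) N)
  · obtain ⟨i, hi, hd⟩ := hvoid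
    have h1 : shortestPathLength p 0 (m • e) (A ∩ Metric.ball 0 (2 * m)) ≤ m ^ p := by
      refine (shortestPathLength_le_dist _ _ _ _).trans (le_of_eq ?_)
      rw [dist_zero_left, norm_smul, he, mul_one, Real.norm_of_nonneg (by linarith)]
    have h2 : m ^ p ≤ 2 ^ p * (N : ℝ) ^ p := by
      rw [← Real.mul_rpow (by norm_num) (by linarith)]
      exact Real.rpow_le_rpow (by linarith) hNm' (by linarith)
    have h3 : (N : ℝ) ^ p ≤ ∑ i ∈ Finset.range (n + 1), (hitRadius N ((i * M) • e) A : ℝ) ^ p := by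
      have := Finset.single_le_sum (f := fun i : ℕ => (hitRadius N ((i * M) • e) A : ℝ) ^ p)
        (fun i _ => by positivity) (Finset.mem_range.2 (Nat.lt_succ_of_le hi))
      simpa only [hitRadius_eq hd] using this
    have h4 : 2 ^ p * (N : ℝ) ^ p ≤ (C + 2 ^ p) * ∑ i ∈ Finset.range (n + 1),
        (hitRadius N ((i * M) • e) A : ℝ) ^ p :=
      mul_le_mul (by linarith) h3 (by positivity) (by linarith)
    have := mul_nonneg (by linarith : 0 ≤ κ) hsum1
    linarith
  · push Not at hvoid
    choose! q hqA hq using fun i hi => exists_dist_lt_hitRadius (hvoid i hi)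
    set s : ℕ → E := fun i => if i ≤ n then (i * M) • e else m • e with hs
    have hsi : ∀ i ≤ n, s i = (i * M) • e := fun i hi => if_pos hi
    have hsn : s (n + 1) = m • e := if_neg (by omega)
    have hs0 : s 0 = 0 := by rw [hsi 0 (by omega)]; simp
    set q' : ℕ → E := fun i => if 0 < i ∧ i ≤ n then q i else s i with hq'
    have hns : ∀ i ≤ n, ‖((i : ℝ) * M) • e‖ ≤ m := fun i hi => by
      rw [norm_smul, he, mul_one, Real.norm_of_nonneg (by positivity)]
      refine le_trans ?_ hnM
      have : (i : ℝ) ≤ n := by exact_mod_cast hi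
      gcongr
    have hdist : ∀ i ≤ n, dist (s i) (q' i) ≤ hitRadius N ((i * M) • e) A := by
      intro i hi
      simp only [hq']
      split_ifs
      · rw [hsi i hi]; exact (hq i hi).le
      · simp
    have hmain := hC (n + 1) s q' (A ∩ Metric.ball 0 (2 * m)) (if_neg (by omega)) (if_neg (by omega))
      (fun i hi0 hi => by
        have hi' : i ≤ n := by omega
        rw [show q' i = q i from if_pos ⟨hi0, hi'⟩]
        refine ⟨hqA i hi', ?_⟩
        rw [mem_ball_zero_iff]
        have h1 := hq i hi'
        have h2 : (hitRadius N ((i * M) • e) A : ℝ) ≤ N := by exact_mod_cast hitRadius_le _ _ _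
        have h3 := norm_le_norm_add_norm_sub ((i * M) • e) (q i)
        rw [← dist_eq_norm] at h3
        linarith [hns i hi'])
    rw [hs0, hsn] at hmain
    refine hmain.trans (add_le_add ?_ ?_)
    · refine mul_le_mul_of_nonneg_left ?_ (by linarith)
      rw [Finset.sum_range_succ]
      refine add_le_add (Finset.sum_le_sum fun i hi => ?_) ?_
      · have hi' := Finset.mem_range.1 hi
        rw [hsi i hi'.le, hsi (i + 1) hi', ← add_smul, show ((i + 1 : ℕ) : ℝ) * M = i * M + M by
          push_cast; ring]
        refine shortestPathLength_anti (Set.inter_subset_inter_right _ ?_)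
        refine Metric.ball_subset_ball' ?_
        rw [dist_zero_right]
        linarith [hns i hi'.le]
      · refine (shortestPathLength_le_dist _ _ _ _).trans ?_
        rw [hsn, hsi n le_rfl, dist_eq_norm, ← sub_smul, norm_smul, he, mul_one]
        refine Real.rpow_le_rpow (norm_nonneg _) ?_ (by linarith)
        rw [Real.norm_eq_abs, abs_le]
        constructor <;> linarith
    · refine mul_le_mul (by linarith) (Finset.sum_le_sum fun i hi => ?_)
        (Finset.sum_nonneg fun i _ => Real.rpow_nonneg dist_nonneg _) (by linarith)
      exact Real.rpow_le_rpow dist_nonneg (hdist i (Nat.lt_succ_iff.1 (Finset.mem_range.1 hi)))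
        (by linarith)

variable [FiniteDimensional ℝ E] [MeasurableSpace E] [BorelSpace E] {ν : Measure E}
  [ν.IsAddHaarMeasure] {Q : Measure (Config E)}

/-- The mean path length per unit distance converges, and so does its version for paths in a ball
whose radius is twice the distance. -/
theorem IsPoissonLaw.exists_tendsto_mean [Nontrivial E] (h : IsPoissonLaw ν Q) {p : ℝ} (hp : 1 < p)
    {e : E} (he : ‖e‖ = 1) :
    ∃ C : ℝ, Tendsto (fun t : ℝ => (∫ A, shortestPathLength p 0 (t • e) A.points ∂Q) / t)
        atTop (𝓝 C) ∧
      Tendsto (fun t : ℝ => (∫ A, shortestPathLength p 0 (t • e)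
        (A.points ∩ Metric.ball 0 (2 * t)) ∂Q) / t) atTop (𝓝 C) := by
  have := h.isProbabilityMeasure
  have hint : ∀ (x y s : E) (R : ℝ), Integrable
      (fun A : Config E => shortestPathLength p x y (A.points ∩ Metric.ball s R)) Q := fun x y s R =>
    integrable_shortestPathLength_inter hp x y Metric.isOpen_ball.measurableSet
  refine exists_tendsto_div_of_almost_subadditive (p := p)
    (fun t => integral_nonneg fun A => shortestPathLength_nonneg _ _ _ _)
    (fun t => ?_) fun κ hκ => ?_
  · refine integral_mono ?_ (hint _ _ _ _) fun A => shortestPathLength_anti Set.inter_subset_left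
    simpa using integrable_shortestPathLength_inter (Q := Q) hp 0 (t • e) MeasurableSet.univ
  obtain ⟨C, hC1, hC⟩ := exists_shortestPathLength_le_sum (E := E) hp hκ
  obtain ⟨K, hK0, hK⟩ := h.exists_integral_hitRadius_le (by linarith : 0 < p)
  have h2p : (0 : ℝ) < 2 ^ p := by positivity
  -- The `κ` pays for a truncation error of 1 per block, the rest for hitting radii at `n + 1 ≤
  -- 2m/M` cut points.
  refine ⟨κ + (C + 2 ^ p) * (2 * K), fun M hM => ?_⟩
  have hM0 : 0 < M := by linarith
  obtain ⟨R, hR⟩ := ((tendsto_integral_ball (Q := Q) hp 0 (M • e)).eventually_lt_const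
    (lt_add_one _)).exists
  set a := ∫ A, shortestPathLength p 0 (M • e) A.points ∂Q with ha
  have ha0 : 0 ≤ a := integral_nonneg fun A => shortestPathLength_nonneg _ _ _ _
  filter_upwards [eventually_ge_atTop (1 : ℝ), eventually_ge_atTop (R : ℝ), eventually_ge_atTop M]
    with m hm1 hmR hmM
  set n := ⌊m / M⌋₊ with hn
  have hnm : (n : ℝ) ≤ m / M := Nat.floor_le (by positivity)
  have hmM1 : 1 ≤ m / M := by rwa [one_le_div hM0]
  have hmain : ∫ A, shortestPathLength p 0 (m • e) (A.points ∩ Metric.ball 0 (2 * m)) ∂Q ≤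
      κ * (n * (a + 1) + M ^ p) + (C + 2 ^ p) * ((n + 1) * K) := by
    have hi1 : Integrable (fun A : Config E => ∑ i ∈ Finset.range n,
        shortestPathLength p ((i * M) • e) ((i * M) • e + M • e)
          (A.points ∩ Metric.ball ((i * M) • e) R)) Q :=
      integrable_finsetSum _ fun i _ => hint _ _ _ _
    have hi2 : Integrable (fun A : Config E => ∑ i ∈ Finset.range (n + 1),
        (hitRadius ⌊m⌋₊ ((i * M) • e) A.points : ℝ) ^ p) Q :=
      integrable_finsetSum _ fun i _ => integrable_hitRadius_rpow hp _ _
    have hi0 : Integrable (fun A : Config E => (∑ i ∈ Finset.range n,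
        shortestPathLength p ((i * M) • e) ((i * M) • e + M • e)
          (A.points ∩ Metric.ball ((i * M) • e) R)) + M ^ p) Q := hi1.add (integrable_const _)
    have hi3 := hi0.const_mul κ
    refine (integral_mono (hint _ _ _ _) (hi3.add (hi2.const_mul (C + 2 ^ p)))
      fun A => shortestPathLength_inter_ball_le hp hκ hC1 hC he hM0 hm1 hmR A.points).trans ?_
    rw [integral_add' hi3 (hi2.const_mul _), integral_const_mul, integral_const_mul,
      integral_add hi1 (integrable_const _), integral_finsetSum _ fun i _ => hint _ _ _ _,
      integral_finsetSum _ fun i _ => integrable_hitRadius_rpow hp _ _, integral_const,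
      probReal_univ, one_smul]
    refine add_le_add (mul_le_mul_of_nonneg_left (add_le_add ?_ le_rfl) (by linarith))
      (mul_le_mul_of_nonneg_left ?_ (by linarith))
    · refine (Finset.sum_le_card_nsmul _ _ (a + 1) fun i _ => ?_).trans
        (by rw [Finset.card_range, nsmul_eq_mul])
      rw [h.integral_translate hp]
      exact hR.le
    · refine (Finset.sum_le_card_nsmul _ _ K fun i _ => hK _ _).trans (by simp)
  rw [div_le_iff₀ (by linarith)]
  refine hmain.trans ?_
  have e1 : (κ * (a / M) + (κ + (C + 2 ^ p) * (2 * K)) / M + κ * M ^ p / m) * m =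
      κ * (m / M * (a + 1) + M ^ p) + (C + 2 ^ p) * (2 * (m / M) * K) := by
    field_simp
    ring
  rw [e1]
  gcongr
  linarith

end MeanBound

/-! ### Concentration for a chain of blocks. -/

section Concentration

lemma sum_range_four_mul (f : ℕ → ℝ) (n : ℕ) : ∑ i ∈ Finset.range (4 * n), f i =
    ∑ g : Fin 4, ∑ j ∈ Finset.range n, f (4 * j + g) := by
  induction n with
  | zero => simp
  | succ n ih =>
    rw [show 4 * (n + 1) = 4 * n + 1 + 1 + 1 + 1 by ring]
    simp only [Finset.sum_range_succ, ih, Finset.sum_add_distrib, Fin.sum_univ_four]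
    simp only [Fin.val_zero, Fin.val_one, Fin.val_two, show ((3 : Fin 4) : ℕ) = 3 from rfl]
    simp only [add_assoc, add_zero]

/-- Hoeffding's inequality: a variable with values in `[0, b]` is sub-Gaussian with variance proxy
`(b/2)^2`. -/
lemma measureReal_sum_sub_ge_le {Ω : Type*} [MeasurableSpace Ω] {μ : Measure Ω}
    [IsProbabilityMeasure μ] {X : ℕ → Ω → ℝ} {b a : ℝ} (hX : ∀ i, Measurable (X i))
    (hb : ∀ i ω, X i ω ∈ Set.Icc 0 b) (hind : iIndepFun X μ) (ha : 0 ≤ a) (hb0 : 0 < b) (n : ℕ) :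
    μ.real {ω | n * a ≤ ∑ i ∈ Finset.range n, (X i ω - ∫ ω', X i ω' ∂μ)} ≤
      Real.exp (-(n * (2 * a ^ 2 / b ^ 2))) := by
  have hind' : iIndepFun (fun i ω => X i ω - ∫ ω', X i ω' ∂μ) μ :=
    hind.comp (fun i x => x - ∫ ω', X i ω' ∂μ) fun i => measurable_id.sub_const _
  have := HasSubgaussianMGF.measure_sum_range_ge_le_of_iIndepFun hind' (n := n)
    (fun i _ => hasSubgaussianMGF_of_mem_Icc (hX i).aemeasurable (.of_forall (hb i)))
    (mul_nonneg (Nat.cast_nonneg n) ha)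
  refine this.trans (le_of_eq ?_)
  congr 1
  push_cast
  rw [sub_zero, Real.norm_of_nonneg hb0.le]
  rcases Nat.eq_zero_or_pos n with rfl | hn
  · simp
  · have : (n : ℝ) ≠ 0 := by positivity
    field_simp

variable {E : Type*} [NormedAddCommGroup E] [NormedSpace ℝ E]

/-- An upper bound for the cost of a block of length `m` starting at `s`. -/
noncomputable def blockCost (p κ C m : ℝ) (e s : E) (A : Set E) : ℝ :=
  κ * shortestPathLength p s (s + m • e) A + C * (hitRadius ⌊m⌋₊ s A : ℝ) ^ p

lemma blockCost_mem_Icc {p κ C m : ℝ} (hp : 1 < p) (hκ : 0 ≤ κ) (hC : 0 ≤ C) (hm : 0 ≤ m)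
    {e : E} (he : ‖e‖ = 1) (s : E) (A : Set E) :
    blockCost p κ C m e s A ∈ Set.Icc 0 ((κ + C) * m ^ p) := by
  refine ⟨add_nonneg (mul_nonneg hκ (shortestPathLength_nonneg _ _ _ _))
    (mul_nonneg hC (by positivity)), ?_⟩
  rw [blockCost, add_mul]
  refine add_le_add (mul_le_mul_of_nonneg_left ?_ hκ) (mul_le_mul_of_nonneg_left ?_ hC)
  · refine (shortestPathLength_le_dist _ _ _ _).trans (le_of_eq ?_)
    rw [dist_self_add_right, norm_smul, he, mul_one, Real.norm_of_nonneg hm]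
  · refine Real.rpow_le_rpow (by positivity) ?_ (by linarith)
    exact le_trans (by exact_mod_cast hitRadius_le _ _ _) (Nat.floor_le hm)

/-- The rerouting points lie within `m` of the cut points, and confining each block to its own ball
only increases lengths, so every summand is local. -/
lemma shortestPathLength_le_sum_blockCost {p κ C : ℝ} (hp : 1 < p) (hκ : 1 < κ) (hC1 : 1 ≤ C)
    (hC : ∀ (n : ℕ) (s q : ℕ → E) (A : Set E), q 0 = s 0 → q n = s n →
      (∀ i, 0 < i → i < n → q i ∈ A) →
      shortestPathLength p (s 0) (s n) A ≤
        κ * ∑ i ∈ Finset.range n, shortestPathLength p (s i) (s (i + 1)) A +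
          C * ∑ i ∈ Finset.range n, dist (s i) (q i) ^ p)
    {e : E} {m : ℝ} (hm : 0 ≤ m) {n : ℕ} {A V : Set E}
    (hV : ∀ i < n, Metric.ball ((i * m) • e) (2 * m) ⊆ V)
    (hA : ∀ i < n, ¬ Disjoint A (Metric.ball ((i * m) • e) ⌊m⌋₊)) :
    shortestPathLength p 0 ((n * m) • e) (A ∩ V) ≤ ∑ i ∈ Finset.range n,
      blockCost p κ C m e ((i * m) • e) (A ∩ Metric.ball ((i * m) • e) (2 * m)) := by
  have hNm : (⌊m⌋₊ : ℝ) ≤ m := Nat.floor_le hm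
  choose! q hqA hq using fun i hi => exists_dist_lt_hitRadius (hA i hi)
  set q' : ℕ → E := fun i => if 0 < i ∧ i < n then q i else (i * m) • e with hq'
  have hqV : ∀ i < n, q i ∈ V := fun i hi => hV i hi (by
    have h2 : (hitRadius ⌊m⌋₊ ((i * m) • e) A : ℝ) ≤ ⌊m⌋₊ := by exact_mod_cast hitRadius_le _ _ _
    rw [Metric.mem_ball, dist_comm]
    linarith [hq i hi])
  have hmain := hC n (fun i => (i * m) • e) q' (A ∩ V) (if_neg (by simp)) (if_neg (by simp))
    (fun i hi0 hi => by
      rw [show q' i = q i from if_pos ⟨hi0, hi⟩]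
      exact ⟨hqA i hi, hqV i hi⟩)
  simp only [Nat.cast_zero, zero_mul, zero_smul] at hmain
  refine hmain.trans ?_
  simp only [blockCost]
  rw [Finset.sum_add_distrib, ← Finset.mul_sum, ← Finset.mul_sum]
  refine add_le_add (mul_le_mul_of_nonneg_left (Finset.sum_le_sum fun i hi => ?_) (by linarith))
    (mul_le_mul_of_nonneg_left (Finset.sum_le_sum fun i hi => ?_) (by linarith))
  · rw [← add_smul, show ((i + 1 : ℕ) : ℝ) * m = i * m + m by push_cast; ring]
    exact shortestPathLength_anti (Set.inter_subset_inter_right _ (hV i (Finset.mem_range.1 hi)))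
  · rw [hitRadius_inter (Metric.ball_subset_ball (by linarith))]
    refine Real.rpow_le_rpow dist_nonneg ?_ (by linarith)
    simp only [hq']
    split_ifs
    · exact (hq i (Finset.mem_range.1 hi)).le
    · simp

variable [FiniteDimensional ℝ E] [MeasurableSpace E] [BorelSpace E] {ν : Measure E}
  [ν.IsAddHaarMeasure] {Q : Measure (Config E)}

lemma measurable_blockCost {p : ℝ} (hp : 1 < p) (κ C m : ℝ) (e s : E) :
    Measurable fun A : Config E => blockCost p κ C m e s A.points :=
  ((measurable_shortestPathLength (by linarith) _ _).const_mul κ).add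
    ((measurable_hitRadius_rpow _ _ _).const_mul C)

/-- Starting points with indices congruent mod 4 are at least `4m` apart, so their balls of radius
`2m` are disjoint. -/
lemma IsPoissonLaw.iIndepFun_blockCost (h : IsPoissonLaw ν Q) {p : ℝ} (hp : 1 < p) (κ C : ℝ)
    {m : ℝ} (hm : 0 ≤ m) {e : E} (he : ‖e‖ = 1) (g : ℕ) :
    iIndepFun (fun (j : ℕ) (A : Config E) => blockCost p κ C m e ((((4 * j + g : ℕ) : ℝ) * m) • e)
      (A.points ∩ Metric.ball ((((4 * j + g : ℕ) : ℝ) * m) • e) (2 * m))) Q := by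
  refine (h.iIndepFun_restrict
    (U := fun j : ℕ => Metric.ball ((((4 * j + g : ℕ) : ℝ) * m) • e) (2 * m))
    (fun j => Metric.isOpen_ball.measurableSet) fun i j hij => ?_).comp
    (fun j A => blockCost p κ C m e ((((4 * j + g : ℕ) : ℝ) * m) • e) A.points)
    fun j => measurable_blockCost hp κ C m e _
  refine Metric.ball_disjoint_ball ?_
  rw [dist_eq_norm, ← sub_smul, norm_smul, he, mul_one, ← sub_mul, norm_mul,
    Real.norm_of_nonneg hm]
  have : (1 : ℝ) ≤ |(i : ℝ) - j| := by
    have : (1 : ℤ) ≤ |(i : ℤ) - j| := Int.one_le_abs (sub_ne_zero.2 (by exact_mod_cast hij))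
    exact_mod_cast this
  rw [show ((4 * i + g : ℕ) : ℝ) - ((4 * j + g : ℕ) : ℝ) = 4 * ((i : ℝ) - j) by push_cast; ring,
    Real.norm_eq_abs, abs_mul, abs_of_pos (by norm_num : (0 : ℝ) < 4)]
  nlinarith

/-- Concentration for paths along a chain of `4 * n` blocks of length `m`. -/
theorem IsPoissonLaw.exists_measureReal_gt_le [Nontrivial E] (h : IsPoissonLaw ν Q) {p : ℝ}
    (hp : 1 < p) {e : E} (he : ‖e‖ = 1) {C₀ : ℝ}
    (hC₀ : Tendsto (fun t : ℝ => (∫ A, shortestPathLength p 0 (t • e)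
        (A.points ∩ Metric.ball 0 (2 * t)) ∂Q) / t) atTop (𝓝 C₀)) {ε : ℝ} (hε : 0 < ε) :
    ∃ c : ℝ, 0 < c ∧ ∀ᶠ m : ℝ in atTop, ∀ (n : ℕ) (V : Set E),
      (∀ i < 4 * n, Metric.ball ((i * m) • e) (2 * m) ⊆ V) →
      Q.real {A | (C₀ + ε) * (4 * n * m) <
        shortestPathLength p 0 ((4 * n * m) • e) (A.points ∩ V)} ≤
        4 * Real.exp (-(c * (n * m ^ (2 - 2 * p)))) +
          4 * n * Real.exp (-(c * m ^ Module.finrank ℝ E)) := by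
  have := h.isProbabilityMeasure
  have hC₀0 : 0 ≤ C₀ := by
    refine ge_of_tendsto hC₀ ?_
    filter_upwards [eventually_ge_atTop (0 : ℝ)] with t ht
    exact div_nonneg (integral_nonneg fun A => shortestPathLength_nonneg _ _ _ _) ht
  have hCε : 0 < C₀ + ε / 8 := by linarith
  -- Budget for `ε`: the limit of the means and the factor `κ` use `ε/4`, the hitting radii `ε/4`,
  -- the fluctuations `ε/2`.
  set κ := 1 + (ε / 8) / (C₀ + ε / 8) with hκdef
  have hκ : 1 < κ := by rw [hκdef]; linarith [div_pos (by linarith : 0 < ε / 8) hCε]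
  have hκC : κ * (C₀ + ε / 8) = C₀ + ε / 4 := by rw [hκdef]; field_simp; ring
  obtain ⟨C, hC1, hC⟩ := exists_shortestPathLength_le_sum (E := E) hp hκ
  obtain ⟨K, hK0, hK⟩ := h.exists_integral_hitRadius_le (by linarith : 0 < p)
  set v := ν.real (Metric.ball (0 : E) 1)
  have hv : 0 < v := real_unitBall_pos ν
  set D := Module.finrank ℝ E
  -- `c₁` is the Hoeffding constant for excess `ε m / 2` and range `(κ + C) m^p`; `c₂` comes from
  -- empty balls of radius `⌊m⌋ ≥ m/2`.
  set c₁ := 2 * (ε / 2) ^ 2 / (κ + C) ^ 2 with hc₁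
  set c₂ := v / 2 ^ D with hc₂
  have hc₁0 : 0 < c₁ := by positivity
  have hc₂0 : 0 < c₂ := by positivity
  refine ⟨min c₁ c₂, lt_min hc₁0 hc₂0, ?_⟩
  filter_upwards [hC₀.eventually_lt_const (by linarith : C₀ < C₀ + ε / 8),
    eventually_ge_atTop (1 : ℝ), eventually_ge_atTop (C * K / (ε / 4))] with m hb hm1 hmK n V hV
  have hm0 : 0 < m := by linarith
  rw [div_lt_iff₀ hm0] at hb
  rw [div_le_iff₀ (by linarith)] at hmK
  set s : ℕ → E := fun i => ((i : ℝ) * m) • e with hs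
  set W : ℕ → Config E → ℝ := fun i A =>
    blockCost p κ C m e (s i) (A.points ∩ Metric.ball (s i) (2 * m)) with hW
  set N := ⌊m⌋₊ with hN
  have hNm : (N : ℝ) ≤ m := Nat.floor_le hm0.le
  have hN1 : (1 : ℝ) ≤ N := by exact_mod_cast (Nat.one_le_floor_iff m).2 hm1
  have hNm' : m / 2 ≤ N := by have := Nat.lt_floor_add_one m; rw [← hN] at this; linarith
  have hWm : ∀ i, Measurable (W i) := fun i =>
    (measurable_blockCost hp κ C m e (s i)).comp
      (measurable_restrict (Metric.isOpen_ball (x := s i) (ε := 2 * m)).measurableSet)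
  have hWb : ∀ i A, W i A ∈ Set.Icc 0 ((κ + C) * m ^ p) := fun i A =>
    blockCost_mem_Icc hp (by linarith) (by linarith) hm0.le he _ _
  have hmean : ∀ i, ∫ A, W i A ∂Q ≤ (C₀ + ε / 2) * m := by
    intro i
    have h1 : ∀ A : Config E, W i A = κ * shortestPathLength p (s i) (s i + m • e)
        (A.points ∩ Metric.ball (s i) (2 * m)) + C * (hitRadius N (s i) A.points : ℝ) ^ p := by
      intro A
      simp only [hW, blockCost]
      rw [hitRadius_inter (Metric.ball_subset_ball (by linarith))]
    simp_rw [h1]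
    rw [integral_add ((integrable_shortestPathLength_inter hp _ _
      Metric.isOpen_ball.measurableSet).const_mul _) ((integrable_hitRadius_rpow hp _ _).const_mul _),
      integral_const_mul, integral_const_mul, h.integral_translate hp]
    have h2 := mul_le_mul_of_nonneg_left hb.le (by linarith : 0 ≤ κ)
    rw [← mul_assoc, hκC] at h2
    have h3 := mul_le_mul_of_nonneg_left (hK N (s i)) (by linarith : 0 ≤ C)
    linarith
  -- `G g` is the event that the blocks of residue `g` exceed their total mean by `n ε m / 2`.
  set G : Fin 4 → Set (Config E) := fun g => {A | n * (ε / 2 * m) ≤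
    ∑ j ∈ Finset.range n, (W (4 * j + g) A - ∫ A', W (4 * j + g) A' ∂Q)} with hG
  have hsub : {A : Config E | (C₀ + ε) * (4 * n * m) <
      shortestPathLength p 0 ((4 * n * m) • e) (A.points ∩ V)} ⊆
      (⋃ g ∈ Finset.univ, G g) ∪
        ⋃ i ∈ Finset.range (4 * n), avoidEvent (Metric.ball (s i) (N : ℝ)) := by
    intro A hA
    by_contra hcon
    simp only [Set.mem_union, Set.mem_iUnion, not_or, not_exists, Finset.mem_range,
      Finset.mem_univ, hG, Set.mem_ofPred_eq, not_le, true_implies, mem_avoidEvent] at hcon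
    obtain ⟨hcon1, hcon2⟩ := hcon
    have h1 := shortestPathLength_le_sum_blockCost hp hκ hC1 hC hm0.le hV hcon2
    rw [sum_range_four_mul, Nat.cast_mul, Nat.cast_ofNat] at h1
    have h2 : ∀ g : Fin 4, ∑ j ∈ Finset.range n, W (4 * j + g) A ≤ n * ((C₀ + ε) * m) := by
      intro g
      have h3 := (hcon1 g).le
      rw [Finset.sum_sub_distrib] at h3
      have h4 := Finset.sum_le_card_nsmul (Finset.range n) _ _ fun j _ => hmean (4 * j + g)
      rw [Finset.card_range, nsmul_eq_mul] at h4
      linarith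
    have h5 := Finset.sum_le_sum fun g (_ : g ∈ Finset.univ) => h2 g
    rw [Finset.sum_const, Finset.card_univ, Fintype.card_fin, nsmul_eq_mul] at h5
    push_cast at h5
    have h6 : (C₀ + ε) * (4 * n * m) < _ := hA
    have h7 := h6.trans_le (h1.trans h5)
    linarith
  refine (measureReal_mono hsub).trans ((measureReal_union_le _ _).trans (add_le_add ?_ ?_))
  · refine (measureReal_biUnion_finset_le _ _).trans ?_
    refine (Finset.sum_le_card_nsmul _ _ (Real.exp (-(min c₁ c₂ * (n * m ^ (2 - 2 * p)))))
      fun g _ => ?_).trans (by simp)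
    refine (measureReal_sum_sub_ge_le (fun j => hWm _) (fun j => hWb _)
      (h.iIndepFun_blockCost hp κ C hm0.le he g) (by positivity) (by positivity) n).trans ?_
    rw [Real.exp_le_exp, neg_le_neg_iff]
    have e1 : 2 * (ε / 2 * m) ^ 2 / ((κ + C) * m ^ p) ^ 2 = c₁ * m ^ (2 - 2 * p) := by
      rw [Real.rpow_sub hm0, mul_comm 2 p, Real.rpow_mul hm0.le, hc₁]
      norm_cast
      field_simp
    rw [e1]
    have : 0 ≤ (n : ℝ) * m ^ (2 - 2 * p) := by positivity
    nlinarith [min_le_left c₁ c₂]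
  · refine (measureReal_biUnion_finset_le _ _).trans ?_
    refine (Finset.sum_le_card_nsmul _ _ (Real.exp (-(min c₁ c₂ * m ^ D)))
      fun i _ => ?_).trans (by simp)
    rw [h.real_avoidEvent_ball _ (by positivity), Real.exp_le_exp, neg_le_neg_iff]
    have h1 : (m / 2) ^ D ≤ (N : ℝ) ^ D := pow_le_pow_left₀ (by positivity) hNm' D
    calc min c₁ c₂ * m ^ D ≤ c₂ * m ^ D := by gcongr; exact min_le_right _ _
      _ = (m / 2) ^ D * v := by rw [hc₂, div_pow]; ring
      _ ≤ _ := by gcongr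

end Concentration

/-! ### Reduction to unit intensity and a fixed direction. -/

section PoissonProcess

variable {Ω : Type*} [MeasurableSpace Ω] {P : Measure Ω} {d : ℕ} {lam : ℝ}
  {H : Ω → Set (EuclideanSpace ℝ (Fin d))}

lemma disjoint_image_iff_encard_eq_zero {E F : Type*} (g : E → F) (A : Set E) (B : Set F) :
    Disjoint (g '' A) B ↔ (A ∩ g ⁻¹' B).encard = 0 := by
  rw [Set.disjoint_image_left, Set.encard_eq_zero, Set.disjoint_iff_inter_eq_empty]

lemma IsPoissonProcess.measurable_image (hH : IsPoissonProcess P lam H)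
    {g : EuclideanSpace ℝ (Fin d) → EuclideanSpace ℝ (Fin d)} (hg : Measurable g) :
    Measurable fun ω => (⟨g '' H ω⟩ : Config (EuclideanSpace ℝ (Fin d))) := by
  refine measurable_config fun B hB => ?_
  have : (fun ω => (⟨g '' H ω⟩ : Config (EuclideanSpace ℝ (Fin d)))) ⁻¹' avoidEvent B =
      (fun ω => (H ω ∩ g ⁻¹' B).encard) ⁻¹' {0} := by
    ext ω; exact disjoint_image_iff_encard_eq_zero g (H ω) B
  rw [this]
  exact hH.measurable_count _ (hg hB) (measurableSet_singleton 0)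

/-- The image of a Poisson process of intensity `lam` under a map that scales the volume by `lam`
is a Poisson process of unit intensity. -/
lemma IsPoissonProcess.isPoissonLaw_map [IsProbabilityMeasure P] (hH : IsPoissonProcess P lam H)
    (hlam : 0 < lam) {g : EuclideanSpace ℝ (Fin d) → EuclideanSpace ℝ (Fin d)} (hg : Measurable g)
    (hv : ∀ B, MeasurableSet B → volume (g ⁻¹' B) = ENNReal.ofReal lam⁻¹ * volume B) :
    IsPoissonLaw volume
      (P.map fun ω => (⟨g '' H ω⟩ : Config (EuclideanSpace ℝ (Fin d)))) := by
  have hm := hH.measurable_image hg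
  refine ⟨Measure.isProbabilityMeasure_map hm.aemeasurable, fun B hB hνB => ?_⟩
  have hfin : volume (g ⁻¹' B) ≠ ⊤ := by
    rw [hv B hB]; exact ENNReal.mul_ne_top ENNReal.ofReal_ne_top hνB
  have h1 : (fun ω => (⟨g '' H ω⟩ : Config (EuclideanSpace ℝ (Fin d)))) ⁻¹' avoidEvent B =
      (fun ω => (H ω ∩ g ⁻¹' B).encard) ⁻¹' {0} := by
    ext ω; exact disjoint_image_iff_encard_eq_zero g (H ω) B
  have h2 : lam * (volume (g ⁻¹' B)).toReal = volume.real B := by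
    rw [hv B hB, ENNReal.toReal_mul, ENNReal.toReal_ofReal (by positivity), measureReal_def]
    field_simp
  have h3 : (fun n : ℕ => (n : ℕ∞)) ⁻¹' {0} = {0} := by ext n; simp
  rw [map_measureReal_apply hm (measurableSet_avoidEvent hB), h1, measureReal_def,
    ← Measure.map_apply (hH.measurable_count _ (hg hB)) (measurableSet_singleton 0),
    hH.count_law _ (hg hB) hfin, Measure.map_apply measurable_from_top (measurableSet_singleton 0),
    h3, ← measureReal_def, poissonMeasure_real_singleton, h2,
    Real.coe_toNNReal _ measureReal_nonneg]
  simp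

lemma IsPoissonProcess.isPoissonLaw [IsProbabilityMeasure P] (hH : IsPoissonProcess P 1 H) :
    IsPoissonLaw volume
      (P.map fun ω => (⟨id '' H ω⟩ : Config (EuclideanSpace ℝ (Fin d)))) :=
  hH.isPoissonLaw_map one_pos measurable_id (by simp)

/-- The similarity `g` of ratio `r = λ^(1/d)` sends `x` to `0` and `y` onto the ray of `e`; `V` is
the image of `B(z; R₂)`. Lengths scale by `r^p`, and `r^p * λ^((1-p)/d) = r` matches the
normalization. -/
lemma exists_one_sub_measure_le [IsProbabilityMeasure P] (hH : IsPoissonProcess P lam H)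
    (hd : 0 < d) (hlam : 0 < lam) {Q : Measure (Config (EuclideanSpace ℝ (Fin d)))}
    (hQ : IsPoissonLaw volume Q) {p : ℝ} (hp : 1 < p) {e : EuclideanSpace ℝ (Fin d)}
    (he : ‖e‖ = 1) {x y z : EuclideanSpace ℝ (Fin d)} {R₁ R₂ : ℝ} (hx : x ∈ Metric.ball z R₁)
    (hy : y ∈ Metric.ball z R₁) (hxy : 0 < dist x y) {n : ℕ} {m : ℝ}
    (hnm : 4 * n * m = lam ^ (1 / (d : ℝ)) * dist x y)
    (hm : 2 * m ≤ lam ^ (1 / (d : ℝ)) * (R₂ - R₁)) (c : ℝ) :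
    ∃ V : Set (EuclideanSpace ℝ (Fin d)), (∀ i < 4 * n, Metric.ball ((i * m) • e) (2 * m) ⊆ V) ∧
      1 - P {ω | shortestPathLength p x y (H ω ∩ Metric.ball z R₂) /
        (lam ^ ((1 - p) / (d : ℝ)) * dist x y) ≤ c} ≤
      ENNReal.ofReal (Q.real {A | c * (4 * n * m) <
        shortestPathLength p 0 ((4 * n * m) • e) (A.points ∩ V)}) := by
  have := hQ.isProbabilityMeasure
  have hd' : (0 : ℝ) < d := by exact_mod_cast hd
  set r := lam ^ (1 / (d : ℝ)) with hr
  have hr0 : 0 < r := Real.rpow_pos_of_pos hlam _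
  have hrd : r ^ d = lam := by
    rw [hr, ← Real.rpow_natCast, ← Real.rpow_mul hlam.le, one_div_mul_cancel hd'.ne', Real.rpow_one]
  obtain ⟨ρ, hρ⟩ : ∃ ρ : EuclideanSpace ℝ (Fin d) ≃ₗᵢ[ℝ] EuclideanSpace ℝ (Fin d),
      ρ (y - x) = dist x y • e := by
    -- Two vectors of equal norm are exchanged by the reflection in their bisecting hyperplane.
    refine ⟨_, Submodule.reflection_sub (v := y - x) (w := dist x y • e) ?_⟩
    rw [norm_smul, he, mul_one, Real.norm_of_nonneg dist_nonneg, dist_comm, dist_eq_norm]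
  set g : EuclideanSpace ℝ (Fin d) → EuclideanSpace ℝ (Fin d) := fun v => r • ρ (v - x) with hg
  have hgd : ∀ a b, dist (g a) (g b) = r * dist a b := by
    intro a b
    rw [hg, dist_smul₀, ρ.dist_map, dist_sub_right, Real.norm_of_nonneg hr0.le]
  have hgx : g x = 0 := by simp [hg]
  have hgy : g y = (4 * n * m) • e := by simp only [hg]; rw [hρ, smul_smul, hnm]
  have hgm : Measurable g := by
    have : Continuous g := by rw [hg]; fun_prop
    exact this.measurable
  have hgv : ∀ B, MeasurableSet B → volume (g ⁻¹' B) = ENNReal.ofReal lam⁻¹ * volume B := by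
    intro B hB
    have h1 : g ⁻¹' B = (fun v => v - x) ⁻¹' (ρ ⁻¹' ((r • ·) ⁻¹' B)) := rfl
    have hB1 : MeasurableSet ((r • ·) ⁻¹' B : Set (EuclideanSpace ℝ (Fin d))) :=
      measurable_const_smul r hB
    rw [h1, (measurePreserving_sub_right volume x).measure_preimage
      (ρ.continuous.measurable hB1).nullMeasurableSet,
      ρ.measurePreserving.measure_preimage hB1.nullMeasurableSet,
      Measure.addHaar_preimage_smul _ hr0.ne', finrank_euclideanSpace_fin, hrd,
      abs_of_pos (by positivity)]
  set V := Metric.ball (g z) (r * R₂) with hV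
  set Φ : Ω → Config (EuclideanSpace ℝ (Fin d)) := fun ω => ⟨g '' H ω⟩ with hΦ
  have hΦm : Measurable Φ := hH.measurable_image hgm
  have hQΦ : P.map Φ = Q := (hH.isPoissonLaw_map hlam hgm hgv).unique hQ
  set bad : Set (Config (EuclideanSpace ℝ (Fin d))) := {A | c * (4 * n * m) <
    shortestPathLength p 0 ((4 * n * m) • e) (A.points ∩ V)} with hbad
  have hbadm : MeasurableSet bad := measurableSet_lt measurable_const
    (measurable_shortestPathLength_inter hp _ _ Metric.isOpen_ball.measurableSet)
  refine ⟨V, fun i hi => ?_, ?_⟩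
  -- Each cut point is the image of a point of the segment, which lies in `B(z; R₁)` by convexity;
  -- the margin `r (R₂ - R₁) ≥ 2m` leaves room for the ball.
  · have hn0 : (0 : ℝ) < 4 * n := by
      have : 0 < n := by omega
      positivity
    set θ : ℝ := i / (4 * n) with hθ
    have hθ0 : 0 ≤ θ := by positivity
    have hθ1 : θ ≤ 1 := (div_le_one hn0).2 (by exact_mod_cast hi.le)
    have hw : x + θ • (y - x) ∈ Metric.ball z R₁ :=
      (convex_ball z R₁).add_smul_sub_mem hx hy ⟨hθ0, hθ1⟩
    have hgw : g (x + θ • (y - x)) = (i * m) • e := by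
      simp only [hg]
      rw [add_sub_cancel_left, map_smul, hρ, smul_smul, smul_smul]
      congr 1
      rw [mul_right_comm, ← hnm, hθ, mul_right_comm, mul_div_cancel₀ _ hn0.ne']
    refine Metric.ball_subset_ball' ?_
    rw [← hgw, hgd]
    have := mul_le_mul_of_nonneg_left (Metric.mem_ball.1 hw).le hr0.le
    linarith
  -- An inclusion suffices for the bound, so the good event itself need not be shown measurable.
  · have hsub : Φ ⁻¹' badᶜ ⊆ {ω | shortestPathLength p x y (H ω ∩ Metric.ball z R₂) /
        (lam ^ ((1 - p) / (d : ℝ)) * dist x y) ≤ c} := by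
      intro ω hω
      have h1 : shortestPathLength p 0 ((4 * n * m) • e) (g '' H ω ∩ V) ≤ c * (4 * n * m) :=
        not_lt.1 hω
      have h2 : shortestPathLength p 0 ((4 * n * m) • e) (g '' (H ω ∩ Metric.ball z R₂)) ≤
          shortestPathLength p 0 ((4 * n * m) • e) (g '' H ω ∩ V) := by
        refine shortestPathLength_anti ?_
        rintro _ ⟨⟨v, hv, rfl⟩, hv'⟩
        rw [hV, Metric.mem_ball, hgd] at hv'
        exact ⟨v, ⟨hv, lt_of_mul_lt_mul_left hv' hr0.le⟩, rfl⟩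
      have h3 := shortestPathLength_image hp hr0 hgd x y (H ω ∩ Metric.ball z R₂)
      rw [hgx, hgy] at h3
      rw [Set.mem_ofPred_eq, div_le_iff₀ (mul_pos (Real.rpow_pos_of_pos hlam _) hxy)]
      have h4 : lam ^ ((1 - p) / (d : ℝ)) = r ^ (1 - p) := by
        rw [hr, ← Real.rpow_mul hlam.le]; congr 1; ring
      have h5 : r = r ^ p * r ^ (1 - p) := by
        rw [← Real.rpow_add hr0, add_sub_cancel, Real.rpow_one]
      have h6 := h2.trans h1
      rw [h3, hnm] at h6
      rw [h4]
      refine le_of_mul_le_mul_left (h6.trans (le_of_eq ?_)) (Real.rpow_pos_of_pos hr0 p)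
      conv_lhs => rw [h5]
      ring
    calc 1 - P _ ≤ 1 - P (Φ ⁻¹' badᶜ) := tsub_le_tsub_left (measure_mono hsub) 1
      _ = Q bad := by
        rw [← Measure.map_apply hΦm hbadm.compl, hQΦ, ← prob_compl_eq_one_sub hbadm.compl,
          compl_compl]
      _ = ENNReal.ofReal (Q.real bad) := (ofReal_measureReal).symm

end PoissonProcess

/-! ### Balancing the two error terms. -/

section Scales

/-- The choice of the number and of the length of the blocks. -/
lemma exists_block_scales {d : ℕ} (hd : 0 < d) {p α c δ B : ℝ} (hp : 1 < p)
    (hα : α = ((d : ℝ) + 2 * p - 1)⁻¹) (hc : 0 < c) (hδ : 0 < δ) (hB : 0 < B) {D : ℝ → ℝ}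
    (hD0 : ∀ l, 0 < l → 0 ≤ D l) (hDB : ∀ l, 0 < l → D l ≤ B)
    (hX : Tendsto (fun l : ℝ => l ^ α * D l) atTop atTop) :
    ∃ c' : ℝ, 0 < c' ∧ ∀ m₁ : ℝ, ∀ᶠ l : ℝ in atTop, ∃ (n : ℕ) (m : ℝ), m₁ ≤ m ∧
      4 * n * m = l ^ (1 / (d : ℝ)) * D l ∧ 2 * m ≤ l ^ (1 / (d : ℝ)) * δ ∧
      4 * Real.exp (-(c * (n * m ^ (2 - 2 * p)))) + 4 * n * Real.exp (-(c * m ^ d)) ≤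
        Real.exp (-(c' * (l ^ α * D l))) := by
  have hd1 : (1 : ℝ) ≤ d := by exact_mod_cast hd
  have hd' : (0 : ℝ) < d := by linarith
  have hs : 0 < (d : ℝ) + 2 * p - 1 := by linarith
  have hα0 : 0 < α := by rw [hα]; positivity
  have hαs : α * ((d : ℝ) + 2 * p - 1) = 1 := by rw [hα]; exact inv_mul_cancel₀ hs.ne'
  have hα1 : α < 1 := by nlinarith
  set k := (2 : ℝ) ^ (1 - 2 * p) / 4 with hk
  have hk0 : 0 < k := by positivity
  -- `c * k` serves the fluctuation term. In the empty-ball term half of `c l^α` dominates `c /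
  -- (2B)` times `X`; the other half absorbs the number of blocks.
  set c₀ := min (c * k) (c / (2 * B)) with hc₀
  have hc₀0 : 0 < c₀ := lt_min (by positivity) (by positivity)
  refine ⟨c₀ / 2, by positivity, fun m₁ => ?_⟩
  have hμ : Tendsto (fun l : ℝ => l ^ (α / d)) atTop atTop := tendsto_rpow_atTop (by positivity)
  have hratio : Tendsto (fun l : ℝ => l ^ (-((1 - α) / d))) atTop (𝓝 0) :=
    tendsto_rpow_neg_atTop (div_pos (by linarith) hd')
  have hexp : Tendsto (fun l : ℝ => (l ^ α) ^ (1 / (d * α)) * Real.exp (-(c / 2) * l ^ α)) atTop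
      (𝓝 0) :=
    (tendsto_rpow_mul_exp_neg_mul_atTop_nhds_zero (1 / (d * α)) (c / 2) (by positivity)).comp
      (tendsto_rpow_atTop hα0)
  filter_upwards [eventually_ge_atTop (1 : ℝ), hμ.eventually_ge_atTop (max m₁ 1),
    hX.eventually_ge_atTop 4, hX.eventually_ge_atTop (Real.log 8 / (c₀ / 2)),
    hratio.eventually_lt_const (by positivity : 0 < δ / 4),
    hexp.eventually_lt_const (by positivity : 0 < 1 / B)] with l hl1 hlμ hX4 hX8 hlr hle
  have hl0 : 0 < l := by linarith
  set X := l ^ α * D l with hXdef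
  -- The balancing scale: `μ^d = l^α` and `t μ^(1-2p) = X`, the latter by `α (d + 2p - 1) = 1`.
  set μ := l ^ (α / d) with hμdef
  have hμ0 : 0 < μ := Real.rpow_pos_of_pos hl0 _
  have hμ1 : 1 ≤ μ := (le_max_right _ _).trans hlμ
  set t := l ^ (1 / (d : ℝ)) * D l with ht
  have ht0 : 0 ≤ t := mul_nonneg (by positivity) (hD0 l hl0)
  have htX : X ≤ t / μ := by
    -- Here `α (d + 1) ≤ 1` because `p > 1`; hence `X ≥ 4` leaves room for at least one group of
    -- four blocks.
    rw [le_div_iff₀ hμ0]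
    have : l ^ α * l ^ (α / d) ≤ l ^ (1 / (d : ℝ)) := by
      rw [← Real.rpow_add hl0]
      refine Real.rpow_le_rpow_of_exponent_le hl1 ?_
      rw [le_div_iff₀ hd', add_mul, div_mul_cancel₀ _ hd'.ne']
      nlinarith
    calc X * μ = (l ^ α * l ^ (α / d)) * D l := by rw [hXdef, hμdef]; ring
      _ ≤ _ := mul_le_mul_of_nonneg_right this (hD0 l hl0)
  have hq1 : 1 ≤ t / (4 * μ) := by
    have : t / (4 * μ) = t / μ / 4 := by field_simp
    rw [this]; linarith
  set n := ⌊t / (4 * μ)⌋₊ with hn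
  have hn1 : (1 : ℝ) ≤ n := by exact_mod_cast (Nat.one_le_floor_iff _).2 hq1
  have hnle : (n : ℝ) ≤ t / (4 * μ) := Nat.floor_le (by linarith)
  have hnlt : t / (4 * μ) < 2 * n := by
    have := Nat.lt_floor_add_one (t / (4 * μ)); rw [← hn] at this; linarith
  rw [le_div_iff₀ (by positivity)] at hnle
  rw [div_lt_iff₀ (by positivity)] at hnlt
  -- Rounding is absorbed by the length, so that `4 n m = t` exactly while `μ ≤ m ≤ 2 μ`.
  set m := t / (4 * n) with hm
  have hn0 : (0 : ℝ) < 4 * n := by linarith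
  have hmμ : μ ≤ m := by rw [hm, le_div_iff₀ hn0]; linarith
  have hmμ2 : m ≤ 2 * μ := by rw [hm, div_le_iff₀ hn0]; linarith
  have hm0 : 0 < m := by linarith
  have hnm : 4 * n * m = t := by rw [hm]; field_simp
  refine ⟨n, m, ((le_max_left _ _).trans hlμ).trans hmμ, hnm, ?_, ?_⟩
  · have h1 : μ = l ^ (1 / (d : ℝ)) * l ^ (-((1 - α) / d)) := by
      rw [← Real.rpow_add hl0, hμdef]; congr 1; field_simp; ring
    have h2 : l ^ (1 / (d : ℝ)) * l ^ (-((1 - α) / d)) ≤ l ^ (1 / (d : ℝ)) * (δ / 4) := by gcongr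
    linarith
  · have hX0 : 0 ≤ X := by linarith
    have h1 : k * X ≤ n * m ^ (2 - 2 * p) := by
      have e1 : n * m ^ (2 - 2 * p) = t / 4 * m ^ (1 - 2 * p) := by
        rw [show 2 - 2 * p = 1 + (1 - 2 * p) by ring, Real.rpow_add hm0, Real.rpow_one, ← hnm]
        ring
      have e2 : (2 * μ) ^ (1 - 2 * p) ≤ m ^ (1 - 2 * p) :=
        Real.rpow_le_rpow_of_nonpos hm0 hmμ2 (by linarith)
      have e3 : l ^ (1 / (d : ℝ)) * μ ^ (1 - 2 * p) = l ^ α := by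
        rw [hμdef, ← Real.rpow_mul hl0.le, ← Real.rpow_add hl0]
        congr 1
        field_simp
        linarith
      calc k * X = t / 4 * (2 * μ) ^ (1 - 2 * p) := by
            rw [Real.mul_rpow (by norm_num) hμ0.le, hk, hXdef, ← e3, ht]; ring
        _ ≤ t / 4 * m ^ (1 - 2 * p) := by gcongr
        _ = _ := e1.symm
    have h2 : l ^ α ≤ m ^ d := by
      calc l ^ α = μ ^ d := by
            rw [hμdef, ← Real.rpow_natCast, ← Real.rpow_mul hl0.le, div_mul_cancel₀ _ hd'.ne']
        _ ≤ m ^ d := pow_le_pow_left₀ hμ0.le hmμ d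
    have h3 : X ≤ B * l ^ α := by
      rw [hXdef, mul_comm]; exact mul_le_mul_of_nonneg_right (hDB l hl0) (by positivity)
    have h4 : (n : ℝ) ≤ B * l ^ (1 / (d : ℝ)) := by
      have : t ≤ B * l ^ (1 / (d : ℝ)) := by
        rw [ht, mul_comm]; exact mul_le_mul_of_nonneg_right (hDB l hl0) (by positivity)
      nlinarith
    have h5 : n * Real.exp (-(c / 2) * l ^ α) ≤ 1 := by
      rw [← Real.rpow_mul hl0.le, show α * (1 / (d * α)) = 1 / (d : ℝ) by field_simp] at hle
      rw [lt_div_iff₀ hB] at hle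
      calc n * Real.exp (-(c / 2) * l ^ α) ≤
          B * l ^ (1 / (d : ℝ)) * Real.exp (-(c / 2) * l ^ α) := by gcongr
        _ ≤ 1 := by linarith
    have h6 : Real.exp (-(c * (n * m ^ (2 - 2 * p)))) ≤ Real.exp (-(c₀ * X)) := by
      rw [Real.exp_le_exp, neg_le_neg_iff]
      calc c₀ * X ≤ c * k * X := by gcongr; exact min_le_left _ _
        _ = c * (k * X) := by ring
        _ ≤ _ := by gcongr
    have h7 : n * Real.exp (-(c * m ^ d)) ≤ Real.exp (-(c₀ * X)) := by
      have e1 : Real.exp (-(c * m ^ d)) ≤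
          Real.exp (-(c / 2) * l ^ α) * Real.exp (-(c₀ * X)) := by
        rw [← Real.exp_add, Real.exp_le_exp]
        have e2 : c₀ * X ≤ c / 2 * l ^ α := by
          calc c₀ * X ≤ c / (2 * B) * X := by gcongr; exact min_le_right _ _
            _ ≤ c / (2 * B) * (B * l ^ α) := by gcongr
            _ = _ := by field_simp
        have e3 := mul_le_mul_of_nonneg_left h2 hc.le
        linarith
      calc n * Real.exp (-(c * m ^ d)) ≤
          n * (Real.exp (-(c / 2) * l ^ α) * Real.exp (-(c₀ * X))) := by gcongr
        _ = n * Real.exp (-(c / 2) * l ^ α) * Real.exp (-(c₀ * X)) := by ring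
        _ ≤ 1 * Real.exp (-(c₀ * X)) := by gcongr
        _ = _ := one_mul _
    -- The prefactor 8 is absorbed by giving up half of `c₀`.
    have h8 : 8 ≤ Real.exp (c₀ / 2 * X) := by
      rw [div_le_iff₀ (by positivity)] at hX8
      rw [← Real.log_le_iff_le_exp (by norm_num)]
      linarith
    calc 4 * Real.exp (-(c * (n * m ^ (2 - 2 * p)))) + 4 * n * Real.exp (-(c * m ^ d))
        ≤ 8 * Real.exp (-(c₀ * X)) := by linarith
      _ ≤ Real.exp (c₀ / 2 * X) * Real.exp (-(c₀ * X)) := by gcongr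
      _ = Real.exp (-(c₀ / 2 * X)) := by rw [← Real.exp_add]; congr 1; ring

end Scales

/-! ### The large deviation bound. -/

theorem mainTheorem10 (d : ℕ) (hd : 2 ≤ d) (p : ℝ) (hp : 1 < p) :
    ∃ C : ℝ, ∀ (Ω : Type*) (_ : MeasurableSpace Ω) (P : Measure Ω) (_ : IsProbabilityMeasure P)
      (H : ℝ → Ω → Set (EuclideanSpace ℝ (Fin d))),
      (∀ lam : ℝ, 0 < lam → IsPoissonProcess P lam (H lam)) →
      -- `C` is the constant `C(d, p)`, the limit of the normalized mean at unit intensity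
      Tendsto (fun t : ℝ => (1 / t) * ∫ ω, shortestPathLength p 0
          (t • EuclideanSpace.single (⟨0, Nat.lt_of_lt_of_le Nat.two_pos hd⟩ : Fin d) (1 : ℝ))
          (H 1 ω) ∂P) atTop (𝓝 C) ∧
      ∀ (z : EuclideanSpace ℝ (Fin d)) (R₁ R₂ α : ℝ), 0 < R₁ → R₁ < R₂ →
        α = ((d : ℝ) + 2 * p - 1)⁻¹ →
        ∀ x y : ℝ → EuclideanSpace ℝ (Fin d),
        (∀ lam : ℝ, 0 < lam → x lam ∈ Metric.ball z R₁ ∧ y lam ∈ Metric.ball z R₁) →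
        Tendsto (fun lam : ℝ => lam ^ α * dist (x lam) (y lam)) atTop atTop →
        ∀ ε : ℝ, 0 < ε →
        limsup (fun lam : ℝ =>
          ENNReal.log (1 - P {ω |
              shortestPathLength p (x lam) (y lam) (H lam ω ∩ Metric.ball z R₂) /
                (lam ^ ((1 - p) / (d : ℝ)) * dist (x lam) (y lam)) ≤ C + ε}) /
            ((lam ^ α * dist (x lam) (y lam) : ℝ) : EReal)) atTop < 0 := by
  have hd0 : 0 < d := by omega
  have : NeZero d := ⟨hd0.ne'⟩
  set e : EuclideanSpace ℝ (Fin d) :=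
    EuclideanSpace.single (⟨0, Nat.lt_of_lt_of_le Nat.two_pos hd⟩ : Fin d) (1 : ℝ) with he_def
  have he : ‖e‖ = 1 := by simp [he_def]
  -- `C` must be fixed before the probability space, so it is read off the Poisson law; if there
  -- were none, no process could exist and any `C` would do.
  by_cases hex : ∃ Q : Measure (Config (EuclideanSpace ℝ (Fin d))), IsPoissonLaw volume Q
  swap
  · exact ⟨0, fun Ω _ P _ H hH => (hex ⟨_, (hH 1 one_pos).isPoissonLaw⟩).elim⟩
  obtain ⟨Q, hQ⟩ := hex
  obtain ⟨C, hC, hC'⟩ := hQ.exists_tendsto_mean hp he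
  refine ⟨C, fun Ω _ P _ H hH => ⟨?_, ?_⟩⟩
  · refine hC.congr fun t => ?_
    rw [div_eq_inv_mul, one_div, ← (hH 1 one_pos).isPoissonLaw.unique hQ,
      integral_map ((hH 1 one_pos).measurable_image measurable_id).aemeasurable
        (measurable_shortestPathLength (by linarith) _ _).aestronglyMeasurable]
    simp only [Set.image_id]
  intro z R₁ R₂ α hR₁ hR₁₂ hα x y hxy hX ε hε
  obtain ⟨c, hc, hconc⟩ := hQ.exists_measureReal_gt_le hp he hC' hε
  obtain ⟨m₁, hm₁⟩ := eventually_atTop.1 hconc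
  obtain ⟨c', hc', hscale⟩ := exists_block_scales hd0 hp hα hc (sub_pos.2 hR₁₂)
    (by linarith : 0 < 2 * R₁) (D := fun l => dist (x l) (y l)) (fun l _ => dist_nonneg)
    (fun l hl => by
      have h1 := Metric.mem_ball.1 (hxy l hl).1
      have h2 := Metric.mem_ball.1 (hxy l hl).2
      linarith [dist_triangle_right (x l) (y l) z]) hX
  refine lt_of_le_of_lt (limsup_le_of_le ?_ ?_) (EReal.coe_neg'.2 (neg_lt_zero.2 hc'))
  · isBoundedDefault
  filter_upwards [eventually_gt_atTop (0 : ℝ), hX.eventually_gt_atTop 0, hscale m₁]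
    with l hl hXl ⟨n, m, hmm, hnm, hmδ, hbound⟩
  have hdist : 0 < dist (x l) (y l) := pos_of_mul_pos_right hXl (by positivity)
  obtain ⟨V, hV, hle⟩ := exists_one_sub_measure_le (hH l hl) hd0 hl hQ hp he (hxy l hl).1
    (hxy l hl).2 hdist hnm hmδ (C + ε)
  have h1 := hm₁ m hmm n V hV
  rw [finrank_euclideanSpace_fin] at h1
  have h2 := ENNReal.log_monotone (hle.trans (ENNReal.ofReal_le_ofReal (h1.trans hbound)))
  rw [ENNReal.log_ofReal_of_pos (Real.exp_pos _), Real.log_exp] at h2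
  refine (EReal.div_le_div_right_of_nonneg (by exact_mod_cast hXl.le) h2).trans (le_of_eq ?_)
  rw [← EReal.coe_div]
  congr 1
  field_simp
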